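/- For a positive integer $n$ put $Z(n)=\sum \frac{1}{ijk}$, the sum running over all triples $(i,j,k)$ of positive integers, each coprime to $n$, with $i+j+k=n$. Let $B_0, B_1, B_2,\dots$ be the Bernoulli numbers, defined by $B_0=1$ and $\sum_{i=0}^{n}\binom{n+1}{i}B_i=0$ for $n\ge 1$. For rational numbers $x,y$ whose denominators are prime to $p$, $x\equiv y\pmod{p^\alpha}$ means that $x-y=p^\alpha c$ for some rational number $c$ whose denominator is prime to $p$. Theorem 2. Let $p,q$ be distinct odd primes and let $\alpha,\beta$ be positive integers. Then $$\sum_{\substack{i+j+k=p^\alpha q^\beta\\ i,j,k\ge 1,\ \gcd(ijk,pq)=1}}\frac{(-1)^i}{ijk}\equiv-\frac14 Z(p^\alpha q^\beta)\equiv\frac12(q-2)\left(1-\frac1{q^3}\right)p^{\alpha-1}q^{\beta-1}B_{p-3}\pmod{p^\alpha},$$ where all three quantities have denominators prime to $p$. -/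

import Mathlib

/-- The finite set of all triples `(i, j, k)` of positive integers, each coprime to `m`,
with `i + j + k = n`. (Positive `i, j, k` with sum `n` all lie in `{1, …, n}`.) -/
def coprimeTriples (m n : ℕ) : Finset (ℕ × ℕ × ℕ) :=
  (Finset.Icc 1 n ×ˢ Finset.Icc 1 n ×ˢ Finset.Icc 1 n).filter fun t =>
    t.1 + t.2.1 + t.2.2 = n ∧
      Nat.Coprime t.1 m ∧ Nat.Coprime t.2.1 m ∧ Nat.Coprime t.2.2 m

/-- `Z(n) = ∑ 1 / (i j k)`, over positive integers `i, j, k` prime to `n` with `i + j + k = n`. -/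
def harmonicZ (n : ℕ) : ℚ :=
  ∑ t ∈ coprimeTriples n n, 1 / ((t.1 : ℚ) * (t.2.1 : ℚ) * (t.2.2 : ℚ))

/-- Congruence modulo `m` of rational numbers: both are `m`-integral (reduced denominator prime
to `m`) and their difference is `m` times an `m`-integral rational number. -/
def RatModEq (m : ℕ) (x y : ℚ) : Prop :=
  Nat.Coprime x.den m ∧ Nat.Coprime y.den m ∧
    ∃ c : ℚ, Nat.Coprime c.den m ∧ x - y = (m : ℚ) * c

/-! Write n = p^α q^β. Congruences between p-integral rationals become equalities in `ZMod N`
through `Rat.residue`. The engine is a lifting of triples (`sum_posTriples_mul`). A triple with sum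
(L+1)M and no entry divisible by M is either t + M s, where t is a positive triple of sum M and s ≥
0 has sum L, or M s − t, where s is positive of sum L+2. When M² = 0, 1/(ijk) over the lifts is
±1/(abc) plus a term linear in M, and the signed number of lifts is L+1.

Alternating sum: let O be the part of Z with all entries odd and E the part with only the first
entry odd. Then Z = O + 3E and the alternating sum is S = E − O. Doubling triples gives Z =
8·(all-even triples of sum 2n), and lifting from n to 2n evaluates that sum as 3E − O. Eliminating,
3(4S + Z) = 0 (`three_mul_alternatingTripleSum`). For p = 3 this is proved one power of 3 higher, so
that 3 can be cancelled.

Value of Z: lifting with L + 1 = p gives Z(p^(a+2) q^β) ≡ p Z(p^(a+1) q^β) mod p^(a+2)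
(`tripleSum_prime_mul`), so induction reduces everything to α = 1 modulo p. There multiples of q are
removed by inclusion–exclusion. With T the sum of 1/(abc) over a+b+c = p and c(a) the least x with q
∣ a + p x, only T and ∑ c(a)/(abc) are needed. Partial fractions and a ↦ p − a reduce the latter to
T and ∑ c(a)/a³. Faulhaber's formula gives T = −2B_{p−3}, and a Voronoi-type argument (the map a ↦
(a + p c(a))/q permutes 1, …, p−1) gives 3∑ c(a)/a³ = (1 − q⁻²)B_{p−3}. -/

/-! ### Residues of rationals with denominator prime to the modulus -/

namespace Rat

/-- The residue in `ZMod N` of a rational number whose denominator is prime to `N`. -/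
def residue (N : ℕ) (x : ℚ) : ZMod N := (x.num : ZMod N) * (x.den : ZMod N)⁻¹

variable {N : ℕ} {x y : ℚ}

theorem coprime_den_add (hx : x.den.Coprime N) (hy : y.den.Coprime N) :
    (x + y).den.Coprime N :=
  Nat.Coprime.coprime_dvd_left (Rat.add_den_dvd x y) (hx.mul_left hy)

theorem coprime_den_mul (hx : x.den.Coprime N) (hy : y.den.Coprime N) :
    (x * y).den.Coprime N :=
  Nat.Coprime.coprime_dvd_left (Rat.mul_den_dvd x y) (hx.mul_left hy)

theorem coprime_den_intCast (a : ℤ) : (a : ℚ).den.Coprime N := by simp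

theorem coprime_den_natCast (a : ℕ) : (a : ℚ).den.Coprime N := by simp

theorem coprime_den_neg (hx : x.den.Coprime N) : (-x).den.Coprime N := by simpa

theorem coprime_den_sub (hx : x.den.Coprime N) (hy : y.den.Coprime N) :
    (x - y).den.Coprime N := by
  rw [sub_eq_add_neg]; exact coprime_den_add hx (coprime_den_neg hy)

theorem coprime_den_inv_natCast {a : ℕ} (ha : a.Coprime N) : ((a : ℚ)⁻¹).den.Coprime N := by
  rcases Nat.eq_zero_or_pos a with rfl | h
  · simp
  · rw [Rat.inv_natCast_den_of_pos h]; exact ha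

theorem coprime_den_sum {ι : Type*} {s : Finset ι} {f : ι → ℚ}
    (h : ∀ i ∈ s, (f i).den.Coprime N) : (∑ i ∈ s, f i).den.Coprime N := by
  classical
  induction s using Finset.induction_on with
  | empty => simp
  | insert a s ha ih =>
    rw [Finset.sum_insert ha]
    exact coprime_den_add (h a (by simp)) (ih fun i hi => h i (by simp [hi]))

theorem residue_mul_den (hx : x.den.Coprime N) : residue N x * (x.den : ZMod N) = x.num := by
  have := ZMod.coe_mul_inv_eq_one _ hx
  unfold residue
  linear_combination (x.num : ZMod N) * this

/-- Any fraction a/d with d a unit determines the residue, reduced or not. This is what makes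
compatibility with sums and products a matter of clearing denominators. -/
theorem residue_eq (hx : x.den.Coprime N) {a : ℤ} {d : ℕ} (hd : d.Coprime N) {r : ZMod N}
    (h : x * d = a) (hr : r * d = a) : residue N x = r := by
  have h1 : x.num * (d : ℤ) = a * x.den := by
    have := Rat.mul_den_eq_num x
    have h2 : (x.num : ℚ) * d = a * x.den := by rw [← this, ← h]; ring
    exact_mod_cast h2
  have h2 : (x.num : ZMod N) * d = a * x.den := by exact_mod_cast congrArg (Int.cast (R := ZMod N)) h1
  have h3 := residue_mul_den hx
  have hu : IsUnit ((x.den : ZMod N) * d) :=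
    ((ZMod.isUnit_iff_coprime _ _).2 hx).mul ((ZMod.isUnit_iff_coprime _ _).2 hd)
  apply hu.mul_right_cancel
  linear_combination (d : ZMod N) * h3 + h2 - (x.den : ZMod N) * hr

theorem residue_intCast (a : ℤ) : residue N (a : ℚ) = a := by simp [residue]

theorem residue_natCast (a : ℕ) : residue N (a : ℚ) = a := by simp [residue]

theorem residue_zero : residue N 0 = 0 := by simp [residue]

theorem residue_add (hx : x.den.Coprime N) (hy : y.den.Coprime N) :
    residue N (x + y) = residue N x + residue N y := by
  refine residue_eq (coprime_den_add hx hy) (a := x.num * y.den + y.num * x.den)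
    (d := x.den * y.den) (hx.mul_left hy) ?_ ?_
  · push_cast
    linear_combination (y.den : ℚ) * Rat.mul_den_eq_num x + (x.den : ℚ) * Rat.mul_den_eq_num y
  · push_cast
    linear_combination (y.den : ZMod N) * residue_mul_den hx + (x.den : ZMod N) * residue_mul_den hy

theorem residue_mul (hx : x.den.Coprime N) (hy : y.den.Coprime N) :
    residue N (x * y) = residue N x * residue N y := by
  refine residue_eq (coprime_den_mul hx hy) (a := x.num * y.num)
    (d := x.den * y.den) (hx.mul_left hy) ?_ ?_
  · push_cast
    linear_combination (y.den * y : ℚ) * Rat.mul_den_eq_num x + (x.num : ℚ) * Rat.mul_den_eq_num y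
  · push_cast
    linear_combination (y.den * residue N y : ZMod N) * residue_mul_den hx
      + (x.num : ZMod N) * residue_mul_den hy

theorem residue_neg : residue N (-x) = -residue N x := by
  simp [residue]

theorem residue_sub (hx : x.den.Coprime N) (hy : y.den.Coprime N) :
    residue N (x - y) = residue N x - residue N y := by
  rw [sub_eq_add_neg, residue_add hx (coprime_den_neg hy), residue_neg, sub_eq_add_neg]

theorem residue_inv_natCast {a : ℕ} (ha : a.Coprime N) (h0 : a ≠ 0) :
    residue N ((a : ℚ)⁻¹) = (a : ZMod N)⁻¹ := by
  refine residue_eq (coprime_den_inv_natCast ha) (a := 1) (d := a) ha ?_ ?_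
  · have : (a : ℚ) ≠ 0 := by exact_mod_cast h0
    simp [this]
  · rw [mul_comm, ZMod.coe_mul_inv_eq_one a ha]; simp

theorem residue_sum {ι : Type*} {s : Finset ι} {f : ι → ℚ}
    (h : ∀ i ∈ s, (f i).den.Coprime N) :
    residue N (∑ i ∈ s, f i) = ∑ i ∈ s, residue N (f i) := by
  classical
  induction s using Finset.induction_on with
  | empty => simp [residue_zero]
  | insert a s ha ih =>
    rw [Finset.sum_insert ha, Finset.sum_insert ha, residue_add (h a (by simp))
      (coprime_den_sum fun i hi => h i (by simp [hi])), ih fun i hi => h i (by simp [hi])]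

end Rat

theorem ratModEq_iff_residue {N : ℕ} {x y : ℚ} :
    RatModEq N x y ↔ x.den.Coprime N ∧ y.den.Coprime N ∧ x.residue N = y.residue N := by
  constructor
  · rintro ⟨hx, hy, c, hc, h⟩
    refine ⟨hx, hy, ?_⟩
    have := Rat.residue_sub hx hy
    rw [h, Rat.residue_mul (Rat.coprime_den_natCast N) hc, Rat.residue_natCast] at this
    simpa [sub_eq_zero] using this.symm
  · rintro ⟨hx, hy, h⟩
    refine ⟨hx, hy, ?_⟩
    have hz := Rat.coprime_den_sub hx hy
    have h0 : (x - y).residue N = 0 := by rw [Rat.residue_sub hx hy, h, sub_self]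
    have h1 := Rat.residue_mul_den hz
    rw [h0, zero_mul] at h1
    obtain ⟨k, hk⟩ := (ZMod.intCast_zmod_eq_zero_iff_dvd _ _).1 h1.symm
    refine ⟨k * ((x - y).den : ℚ)⁻¹,
      Rat.coprime_den_mul (Rat.coprime_den_intCast k) (Rat.coprime_den_inv_natCast hz), ?_⟩
    rw [← mul_assoc]
    have : (N : ℚ) * k = (x - y).num := by rw [hk]; push_cast; ring
    rw [this, ← div_eq_mul_inv, Rat.num_div_den]

namespace RatModEq

variable {N : ℕ} {x y z : ℚ}

theorem trans (h : RatModEq N x y) (h' : RatModEq N y z) : RatModEq N x z := by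
  rw [ratModEq_iff_residue] at *; exact ⟨h.1, h'.2.1, h.2.2.trans h'.2.2⟩

theorem mul_left {c : ℚ} (hc : c.den.Coprime N) (h : RatModEq N x y) :
    RatModEq N (c * x) (c * y) := by
  rw [ratModEq_iff_residue] at *
  exact ⟨Rat.coprime_den_mul hc h.1, Rat.coprime_den_mul hc h.2.1, by
    rw [Rat.residue_mul hc h.1, Rat.residue_mul hc h.2.1, h.2.2]⟩

theorem natCast_mul_succ {p a : ℕ} (h : RatModEq (p ^ (a + 1)) x y) :
    RatModEq (p ^ (a + 2)) (p * x) (p * y) := by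
  obtain ⟨hx, hy, c, hc, h⟩ := h
  have key : ∀ {d : ℕ}, d.Coprime (p ^ (a + 1)) → d.Coprime (p ^ (a + 2)) := fun h =>
    Nat.Coprime.pow_right _ (h.coprime_dvd_right (dvd_pow_self p (by omega)))
  exact ⟨Rat.coprime_den_mul (Rat.coprime_den_natCast p) (key hx),
    Rat.coprime_den_mul (Rat.coprime_den_natCast p) (key hy), c, key hc, by
      rw [← mul_sub, h]; push_cast; ring⟩

/-- Cancelling p costs one power of the modulus; needed for p = 3, where the factor 3 in the
alternating identity is not invertible. -/
theorem of_natCast_mul {p a : ℕ} (hp : p ≠ 0) (hx : x.den.Coprime (p ^ (a + 1)))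
    (hy : y.den.Coprime (p ^ (a + 1))) (h : RatModEq (p ^ (a + 2)) (p * x) (p * y)) :
    RatModEq (p ^ (a + 1)) x y := by
  obtain ⟨-, -, c, hc, h⟩ := h
  refine ⟨hx, hy, c, Nat.Coprime.coprime_dvd_right (pow_dvd_pow p (by omega)) hc, ?_⟩
  have hp' : (p : ℚ) ≠ 0 := by exact_mod_cast hp
  apply mul_left_cancel₀ hp'
  rw [mul_sub, h]; push_cast; ring

end RatModEq

/-! ### Triples with a given sum: symmetries, lifting and counting -/

/-- Triples of positive integers with sum `n`. -/
def posTriples (n : ℕ) : Finset (ℕ × ℕ × ℕ) :=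
  (Finset.Icc 1 n ×ˢ Finset.Icc 1 n ×ˢ Finset.Icc 1 n).filter fun t => t.1 + t.2.1 + t.2.2 = n

/-- Triples of natural numbers with sum `n`. -/
def natTriples (n : ℕ) : Finset (ℕ × ℕ × ℕ) :=
  (Finset.range (n + 1) ×ˢ Finset.range (n + 1) ×ˢ Finset.range (n + 1)).filter
    fun t => t.1 + t.2.1 + t.2.2 = n

theorem mem_posTriples {n : ℕ} {t : ℕ × ℕ × ℕ} :
    t ∈ posTriples n ↔ 0 < t.1 ∧ 0 < t.2.1 ∧ 0 < t.2.2 ∧ t.1 + t.2.1 + t.2.2 = n := by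
  simp only [posTriples, Finset.mem_filter, Finset.mem_product, Finset.mem_Icc]
  omega

theorem mem_natTriples {n : ℕ} {t : ℕ × ℕ × ℕ} :
    t ∈ natTriples n ↔ t.1 + t.2.1 + t.2.2 = n := by
  simp only [natTriples, Finset.mem_filter, Finset.mem_product, Finset.mem_range]
  omega

section Permutations

variable {R : Type*} [AddCommMonoid R] (n : ℕ) (f : ℕ → ℕ → ℕ → R)

theorem sum_posTriples_swap₁₂ :
    ∑ t ∈ posTriples n, f t.1 t.2.1 t.2.2 = ∑ t ∈ posTriples n, f t.2.1 t.1 t.2.2 := by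
  refine Finset.sum_nbij' (fun t => (t.2.1, t.1, t.2.2)) (fun t => (t.2.1, t.1, t.2.2))
    ?_ ?_ ?_ ?_ ?_ <;> simp only [mem_posTriples, Prod.mk.eta, implies_true] <;> omega

theorem sum_posTriples_swap₁₃ :
    ∑ t ∈ posTriples n, f t.1 t.2.1 t.2.2 = ∑ t ∈ posTriples n, f t.2.2 t.2.1 t.1 := by
  refine Finset.sum_nbij' (fun t => (t.2.2, t.2.1, t.1)) (fun t => (t.2.2, t.2.1, t.1))
    ?_ ?_ ?_ ?_ ?_ <;> simp only [mem_posTriples, Prod.mk.eta, implies_true] <;> omega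

theorem sum_natTriples_swap₁₂ :
    ∑ t ∈ natTriples n, f t.1 t.2.1 t.2.2 = ∑ t ∈ natTriples n, f t.2.1 t.1 t.2.2 := by
  refine Finset.sum_nbij' (fun t => (t.2.1, t.1, t.2.2)) (fun t => (t.2.1, t.1, t.2.2))
    ?_ ?_ ?_ ?_ ?_ <;> simp only [mem_natTriples, Prod.mk.eta, implies_true] <;> omega

theorem sum_natTriples_swap₁₃ :
    ∑ t ∈ natTriples n, f t.1 t.2.1 t.2.2 = ∑ t ∈ natTriples n, f t.2.2 t.2.1 t.1 := by
  refine Finset.sum_nbij' (fun t => (t.2.2, t.2.1, t.1)) (fun t => (t.2.2, t.2.1, t.1))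
    ?_ ?_ ?_ ?_ ?_ <;> simp only [mem_natTriples, Prod.mk.eta, implies_true] <;> omega

end Permutations

section Slices

variable {R : Type*} [AddCommMonoid R]

theorem sum_natTriples_eq (n : ℕ) (f : ℕ → ℕ → ℕ → R) :
    ∑ t ∈ natTriples n, f t.1 t.2.1 t.2.2 =
      ∑ x ∈ Finset.range (n + 1), ∑ y ∈ Finset.range (n + 1 - x), f x y (n - x - y) := by
  rw [Finset.sum_sigma']
  refine Finset.sum_nbij' (fun t => ⟨t.1, t.2.1⟩) (fun s => (s.1, s.2, n - s.1 - s.2))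
    ?_ ?_ ?_ ?_ ?_
  · intro t; simp only [mem_natTriples, Finset.mem_sigma, Finset.mem_range]; omega
  · intro t; simp only [mem_natTriples, Finset.mem_sigma, Finset.mem_range]; omega
  · rintro ⟨x, y, z⟩; simp only [mem_natTriples, Prod.mk.injEq, true_and]; omega
  · rintro ⟨x, y⟩; simp
  · rintro ⟨x, y, z⟩; simp only [mem_natTriples]; intro h
    congr 1; omega

theorem sum_posTriples_eq (n : ℕ) (f : ℕ → ℕ → ℕ → R) :
    ∑ t ∈ posTriples n, f t.1 t.2.1 t.2.2 =
      ∑ x ∈ Finset.Ico 1 n, ∑ y ∈ Finset.Ico 1 (n - x), f x y (n - x - y) := by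
  rw [Finset.sum_sigma']
  refine Finset.sum_nbij' (fun t => ⟨t.1, t.2.1⟩) (fun s => (s.1, s.2, n - s.1 - s.2))
    ?_ ?_ ?_ ?_ ?_
  · intro t; simp only [mem_posTriples, Finset.mem_sigma, Finset.mem_Ico]; omega
  · intro t; simp only [mem_posTriples, Finset.mem_sigma, Finset.mem_Ico]; omega
  · rintro ⟨x, y, z⟩; simp only [mem_posTriples, Prod.mk.injEq, true_and]; omega
  · rintro ⟨x, y⟩; simp
  · rintro ⟨x, y, z⟩; simp only [mem_posTriples]; intro h
    congr 1; omega

end Slices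

/-- Reduce each entry modulo M. The three nonzero remainders sum to M or 2M. In the first case they
form t and the quotients sum to L; in the second, their complements to M form t and the quotients
plus one sum to L + 2. Triples with an entry divisible by M are discarded by `hf`. -/
theorem sum_posTriples_mul {R : Type*} [AddCommMonoid R] {L M : ℕ} (hM : 0 < M)
    (f : ℕ → ℕ → ℕ → R)
    (hf : ∀ i j k, M ∣ i ∨ M ∣ j ∨ M ∣ k → f i j k = 0) :
    ∑ t ∈ posTriples ((L + 1) * M), f t.1 t.2.1 t.2.2 =
      ∑ t ∈ posTriples M,
        (∑ s ∈ natTriples L, f (t.1 + M * s.1) (t.2.1 + M * s.2.1) (t.2.2 + M * s.2.2) +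
        ∑ s ∈ posTriples (L + 2), f (M * s.1 - t.1) (M * s.2.1 - t.2.1) (M * s.2.2 - t.2.2)) := by
  classical
  have hdm : ∀ i, M * (i / M) + i % M = i := fun i => Nat.div_add_mod i M
  have hlt : ∀ i, i % M < M := fun i => Nat.mod_lt i hM
  set F := (posTriples ((L + 1) * M)).filter
    fun t => ¬ M ∣ t.1 ∧ ¬ M ∣ t.2.1 ∧ ¬ M ∣ t.2.2 with hF
  have hmemF : ∀ {t : ℕ × ℕ × ℕ}, t ∈ F ↔ 0 < t.1 % M ∧ 0 < t.2.1 % M ∧ 0 < t.2.2 % M ∧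
      t.1 + t.2.1 + t.2.2 = (L + 1) * M := by
    intro t
    simp only [hF, Finset.mem_filter, mem_posTriples, Nat.dvd_iff_mod_eq_zero]
    have := hdm t.1
    have := hdm t.2.1
    have := hdm t.2.2
    constructor
    · rintro ⟨h1, h2⟩; omega
    · rintro ⟨h1, h2, h3, h4⟩
      have := Nat.mod_le t.1 M
      have := Nat.mod_le t.2.1 M
      have := Nat.mod_le t.2.2 M
      omega
  have h1 : ∑ t ∈ posTriples ((L + 1) * M), f t.1 t.2.1 t.2.2 = ∑ t ∈ F, f t.1 t.2.1 t.2.2 := by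
    symm
    apply Finset.sum_filter_of_ne
    intro t _ h
    by_contra h'
    apply h
    apply hf
    tauto
  rw [h1, ← Finset.sum_filter_add_sum_filter_not F
    (fun t => t.1 % M + t.2.1 % M + t.2.2 % M = M), Finset.sum_add_distrib]
  have hquot : ∀ i r x, r < M → i = M * x + r → i / M = x ∧ i % M = r := by
    rintro i r x hr rfl
    refine ⟨?_, ?_⟩
    · rw [Nat.mul_add_div hM, Nat.div_eq_of_lt hr, add_zero]
    · rw [Nat.mul_add_mod, Nat.mod_eq_of_lt hr]
  have hbound : ∀ t : ℕ × ℕ × ℕ, t ∈ posTriples M → t.1 < M ∧ t.2.1 < M ∧ t.2.2 < M := by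
    intro t; rw [mem_posTriples]; omega
  congr 1
  · rw [← Finset.sum_product']
    refine Finset.sum_nbij'
      (fun t => ((t.1 % M, t.2.1 % M, t.2.2 % M), (t.1 / M, t.2.1 / M, t.2.2 / M)))
      (fun s => (s.1.1 + M * s.2.1, s.1.2.1 + M * s.2.2.1, s.1.2.2 + M * s.2.2.2)) ?_ ?_ ?_ ?_ ?_
    · rintro ⟨i, j, k⟩ h
      simp only [Finset.mem_filter, hmemF, Finset.mem_product, mem_posTriples,
        mem_natTriples] at h ⊢
      refine ⟨by omega, ?_⟩
      have := hdm i; have := hdm j; have := hdm k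
      apply Nat.eq_of_mul_eq_mul_left hM
      rw [mul_add, mul_add]
      have : M * L + M = (L + 1) * M := by ring
      omega
    · rintro ⟨⟨a, b, c⟩, ⟨x, y, z⟩⟩ h
      simp only [Finset.mem_filter, hmemF, Finset.mem_product, mem_natTriples] at h ⊢
      obtain ⟨h, rfl⟩ := h
      obtain ⟨ha, hb, hc⟩ := hbound _ h
      rw [mem_posTriples] at h
      simp only [Nat.add_mul_mod_self_left] at *
      rw [Nat.mod_eq_of_lt ha, Nat.mod_eq_of_lt hb, Nat.mod_eq_of_lt hc]
      refine ⟨⟨h.1, h.2.1, h.2.2.1, ?_⟩, h.2.2.2⟩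
      have := h.2.2.2
      linear_combination this
    · rintro ⟨i, j, k⟩ _
      simp only [Nat.mod_add_div]
    · rintro ⟨⟨a, b, c⟩, ⟨x, y, z⟩⟩ h
      simp only [Finset.mem_product] at h
      obtain ⟨ha, hb, hc⟩ := hbound _ h.1
      obtain ⟨h1, h2⟩ := hquot _ _ x ha (add_comm _ _)
      obtain ⟨h3, h4⟩ := hquot _ _ y hb (add_comm _ _)
      obtain ⟨h5, h6⟩ := hquot _ _ z hc (add_comm _ _)
      simp only at h1 h2 h3 h4 h5 h6
      simp only [h1, h2, h3, h4, h5, h6]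
    · rintro ⟨i, j, k⟩ _
      simp only [Nat.mod_add_div]
  · rw [← Finset.sum_product']
    have hsub : ∀ a x, 0 < a → a < M → 0 < x → M * x - a = M * (x - 1) + (M - a) := by
      intro a x ha ha' hx
      obtain ⟨y, rfl⟩ : ∃ y, x = y + 1 := ⟨x - 1, by omega⟩
      rw [Nat.add_sub_cancel, mul_add, mul_one]; omega
    have hback : ∀ i, M * (i / M + 1) - (M - i % M) = i := by
      intro i
      have := hdm i; have := hlt i
      rw [mul_add, mul_one]; omega
    refine Finset.sum_nbij'
      (fun t => ((M - t.1 % M, M - t.2.1 % M, M - t.2.2 % M),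
        (t.1 / M + 1, t.2.1 / M + 1, t.2.2 / M + 1)))
      (fun s => (M * s.2.1 - s.1.1, M * s.2.2.1 - s.1.2.1, M * s.2.2.2 - s.1.2.2)) ?_ ?_ ?_ ?_ ?_
    · rintro ⟨i, j, k⟩ h
      simp only [Finset.mem_filter, hmemF, Finset.mem_product, mem_posTriples] at h ⊢
      have h1 := hdm i; have h2 := hdm j; have h3 := hdm k
      have l1 := hlt i; have l2 := hlt j; have l3 := hlt k
      have hs : M * (i / M + j / M + k / M) + (i % M + j % M + k % M) = (L + 1) * M := by
        rw [mul_add, mul_add]; omega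
      have hd : M ∣ i % M + j % M + k % M := by
        rw [← Nat.dvd_add_right (Dvd.intro (i / M + j / M + k / M) rfl), hs]
        exact Dvd.intro_left _ rfl
      obtain ⟨w, hw⟩ := hd
      -- The remainders sum to w M with 0 < w < 3, and w = 1 belongs to the other half of the split.
      have hw3 : w < 3 := by
        by_contra hcon
        have : M * 3 ≤ M * w := Nat.mul_le_mul_left M (by omega)
        omega
      have hw2 : w = 2 := by
        interval_cases w
        · omega
        · omega
        · rfl
      subst hw2
      refine ⟨by omega, Nat.succ_pos _, Nat.succ_pos _, Nat.succ_pos _, ?_⟩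
      have : M * (i / M + j / M + k / M + 2) = M * (L + 1) := by
        rw [mul_add, ← hw, hs, mul_comm]
      have := Nat.eq_of_mul_eq_mul_left hM this
      omega
    · rintro ⟨⟨a, b, c⟩, ⟨x, y, z⟩⟩ h
      simp only [Finset.mem_filter, hmemF, Finset.mem_product] at h ⊢
      obtain ⟨h, h'⟩ := h
      obtain ⟨ha, hb, hc⟩ := hbound _ h
      rw [mem_posTriples] at h h'
      simp only at h h' ha hb hc
      obtain ⟨-, h2⟩ := hquot _ _ _ (by omega) (hsub a x h.1 ha h'.1)
      obtain ⟨-, h4⟩ := hquot _ _ _ (by omega) (hsub b y h.2.1 hb h'.2.1)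
      obtain ⟨-, h6⟩ := hquot _ _ _ (by omega) (hsub c z h.2.2.1 hc h'.2.2.1)
      rw [h2, h4, h6]
      refine ⟨⟨by omega, by omega, by omega, ?_⟩, by omega⟩
      have e1 : a ≤ M * x := ha.le.trans (Nat.le_mul_of_pos_right M h'.1)
      have e2 : b ≤ M * y := hb.le.trans (Nat.le_mul_of_pos_right M h'.2.1)
      have e3 : c ≤ M * z := hc.le.trans (Nat.le_mul_of_pos_right M h'.2.2.1)
      have e4 : M * x + M * y + M * z = (L + 1) * M + M := by
        rw [← mul_add, ← mul_add, h'.2.2.2]; ring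
      omega
    · rintro ⟨i, j, k⟩ _
      simp only [hback]
    · rintro ⟨⟨a, b, c⟩, ⟨x, y, z⟩⟩ h
      simp only [Finset.mem_product] at h
      obtain ⟨h, h'⟩ := h
      obtain ⟨ha, hb, hc⟩ := hbound _ h
      rw [mem_posTriples] at h h'
      simp only at h h' ha hb hc
      obtain ⟨h1, h2⟩ := hquot _ _ _ (by omega) (hsub a x h.1 ha h'.1)
      obtain ⟨h3, h4⟩ := hquot _ _ _ (by omega) (hsub b y h.2.1 hb h'.2.1)
      obtain ⟨h5, h6⟩ := hquot _ _ _ (by omega) (hsub c z h.2.2.1 hc h'.2.2.1)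
      simp only [h1, h2, h3, h4, h5, h6, Prod.mk.injEq]
      omega
    · rintro ⟨i, j, k⟩ _
      simp only [hback]

theorem card_natTriples (n : ℕ) : 2 * (natTriples n).card = (n + 1) * (n + 2) := by
  have h := sum_natTriples_eq n (fun _ _ _ => 1)
  simp only [Finset.sum_const, smul_eq_mul, mul_one, Finset.card_range] at h
  rw [h, ← Finset.sum_range_reflect]
  have : ∀ x ∈ Finset.range (n + 1), n + 1 - (n + 1 - 1 - x) = x + 1 := by
    intro x hx; rw [Finset.mem_range] at hx; omega
  rw [Finset.sum_congr rfl this, Finset.sum_add_distrib, mul_add, mul_comm 2 (Finset.sum _ _),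
    Finset.sum_range_id_mul_two]
  simp
  ring

theorem sum_posTriples_shift {R : Type*} [AddCommMonoid R] (n : ℕ) (f : ℕ → ℕ → ℕ → R) :
    ∑ t ∈ posTriples (n + 3), f t.1 t.2.1 t.2.2 =
      ∑ t ∈ natTriples n, f (t.1 + 1) (t.2.1 + 1) (t.2.2 + 1) := by
  refine Finset.sum_nbij' (fun t => (t.1 - 1, t.2.1 - 1, t.2.2 - 1))
    (fun t => (t.1 + 1, t.2.1 + 1, t.2.2 + 1)) ?_ ?_ ?_ ?_ ?_
  · intro t; simp only [mem_natTriples, mem_posTriples]; omega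
  · intro t; simp only [mem_natTriples, mem_posTriples]; omega
  · rintro ⟨x, y, z⟩; simp only [mem_posTriples, Prod.mk.injEq]; omega
  · rintro ⟨x, y, z⟩; simp
  · rintro ⟨x, y, z⟩; simp only [mem_posTriples]; intro h
    congr 1 <;> omega

theorem card_posTriples (n : ℕ) : 2 * (posTriples (n + 2)).card = n * (n + 1) := by
  cases n with
  | zero => decide
  | succ n =>
    have h := sum_posTriples_shift n (fun _ _ _ => 1)
    simp only [Finset.sum_const, smul_eq_mul, mul_one] at h
    rw [show n + 1 + 2 = n + 3 from rfl, h, card_natTriples]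

/-- Lifts of the second kind carry the opposite sign to leading order, so this difference is the
multiplicity with which a triple is counted. -/
theorem card_natTriples_eq_add (n : ℕ) :
    (natTriples n).card = (posTriples (n + 2)).card + (n + 1) := by
  have h1 := card_natTriples n
  have h2 := card_posTriples n
  nlinarith

theorem three_mul_sum_natTriples_fst (n : ℕ) :
    3 * ∑ t ∈ natTriples n, t.1 = n * (natTriples n).card := by
  have h2 := sum_natTriples_swap₁₂ n (fun x _ _ => x)
  have h3 := sum_natTriples_swap₁₃ n (fun x _ _ => x)
  calc 3 * ∑ t ∈ natTriples n, t.1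
      = ∑ t ∈ natTriples n, t.1 + ∑ t ∈ natTriples n, t.2.1 + ∑ t ∈ natTriples n, t.2.2 := by
        rw [← h2, ← h3]; ring
    _ = ∑ t ∈ natTriples n, n := by
        rw [← Finset.sum_add_distrib, ← Finset.sum_add_distrib]
        exact Finset.sum_congr rfl fun t ht => mem_natTriples.1 ht
    _ = _ := by simp [mul_comm]

theorem three_mul_sum_posTriples_fst (n : ℕ) :
    3 * ∑ t ∈ posTriples n, t.1 = n * (posTriples n).card := by
  have h2 := sum_posTriples_swap₁₂ n (fun x _ _ => x)
  have h3 := sum_posTriples_swap₁₃ n (fun x _ _ => x)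
  calc 3 * ∑ t ∈ posTriples n, t.1
      = ∑ t ∈ posTriples n, t.1 + ∑ t ∈ posTriples n, t.2.1 + ∑ t ∈ posTriples n, t.2.2 := by
        rw [← h2, ← h3]; ring
    _ = ∑ t ∈ posTriples n, n := by
        rw [← Finset.sum_add_distrib, ← Finset.sum_add_distrib]
        exact Finset.sum_congr rfl fun t ht => (mem_posTriples.1 ht).2.2.2
    _ = _ := by simp [mul_comm]

/-! ### Sums of inverses in `ZMod N` and their first-order expansion -/

/-- The inverse of `i` in `ZMod N` if `i` is prime to `D`, and `0` otherwise. -/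
def coprimeInv (D N i : ℕ) : ZMod N := if i.Coprime D then (i : ZMod N)⁻¹ else 0

section CoprimeInv

variable {D N M : ℕ}

theorem coprimeInv_of_not_coprime {i : ℕ} (h : ¬ i.Coprime D) : coprimeInv D N i = 0 := if_neg h

theorem coprimeInv_mul_cast (hDN : ∀ i : ℕ, i.Coprime D → i.Coprime N) {i : ℕ} (h : i.Coprime D) :
    coprimeInv D N i * i = 1 := by
  rw [coprimeInv, if_pos h, mul_comm, ZMod.coe_mul_inv_eq_one i (hDN i h)]

theorem coprimeInv_eq_of_mul_cast (hDN : ∀ i : ℕ, i.Coprime D → i.Coprime N) {i : ℕ}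
    (h : i.Coprime D) {r : ZMod N} (hr : r * i = 1) : coprimeInv D N i = r :=
  ((ZMod.isUnit_iff_coprime i N).2 (hDN i h)).mul_right_cancel
    ((coprimeInv_mul_cast hDN h).trans hr.symm)

theorem coprimeInv_of_dvd (hD : D ≠ 1) (hDM : D ∣ M) {i : ℕ} (h : M ∣ i) :
    coprimeInv D N i = 0 := by
  apply coprimeInv_of_not_coprime
  intro h'
  exact hD (Nat.eq_one_of_dvd_coprimes h' (hDM.trans h) dvd_rfl)

theorem coprime_mul_sub_iff (hDM : D ∣ M) {a x : ℕ} (h : a ≤ M * x) :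
    (M * x - a).Coprime D ↔ a.Coprime D := by
  obtain ⟨b, hb⟩ := Nat.exists_eq_add_of_le h
  have hd : D ∣ a + b := hb ▸ hDM.mul_right x
  obtain ⟨k, hk⟩ := hd
  rw [hb, Nat.add_sub_cancel_left]
  constructor
  · intro h
    refine Nat.Coprime.symm (Nat.coprime_of_dvd fun q hq hqD hqa => ?_)
    refine Nat.not_coprime_of_dvd_of_dvd hq.one_lt ?_ hqD h
    exact (Nat.dvd_add_right hqa).1 (hk ▸ hqD.mul_right k)
  · intro h
    refine Nat.Coprime.symm (Nat.coprime_of_dvd fun q hq hqD hqb => ?_)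
    refine Nat.not_coprime_of_dvd_of_dvd hq.one_lt ?_ hqD h
    exact (Nat.dvd_add_left hqb).1 (hk ▸ hqD.mul_right k)

theorem coprime_add_mul_iff (hDM : D ∣ M) {a x : ℕ} :
    (a + M * x).Coprime D ↔ a.Coprime D := by
  obtain ⟨k, rfl⟩ := hDM
  rw [mul_assoc]
  exact Nat.coprime_add_mul_left_left a D (k * x)

/-- The geometric series 1/(a + Mx) = 1/a − Mx/a² stops here because M² = 0; D ∣ M keeps the
coprimality condition unchanged. -/
theorem coprimeInv_add_mul (hDN : ∀ i : ℕ, i.Coprime D → i.Coprime N) (hDM : D ∣ M)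
    (hM : (M : ZMod N) * M = 0) (a x : ℕ) :
    coprimeInv D N (a + M * x) = coprimeInv D N a - M * x * coprimeInv D N a ^ 2 := by
  by_cases h : a.Coprime D
  · apply coprimeInv_eq_of_mul_cast hDN ((coprime_add_mul_iff hDM).2 h)
    have := coprimeInv_mul_cast hDN h
    push_cast
    linear_combination (1 - M * x * coprimeInv D N a) * this - (x * coprimeInv D N a) ^ 2 * hM
  · rw [coprimeInv_of_not_coprime h,
      coprimeInv_of_not_coprime fun h' => h ((coprime_add_mul_iff hDM).1 h')]
    ring

theorem coprimeInv_mul_sub (hDN : ∀ i : ℕ, i.Coprime D → i.Coprime N) (hDM : D ∣ M)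
    (hM : (M : ZMod N) * M = 0) {a x : ℕ} (hax : a ≤ M * x) :
    coprimeInv D N (M * x - a) = -coprimeInv D N a - M * x * coprimeInv D N a ^ 2 := by
  by_cases h : a.Coprime D
  · apply coprimeInv_eq_of_mul_cast hDN ((coprime_mul_sub_iff hDM hax).2 h)
    have := coprimeInv_mul_cast hDN h
    push_cast [hax]
    linear_combination (1 + M * x * coprimeInv D N a) * this - (x * coprimeInv D N a) ^ 2 * hM
  · rw [coprimeInv_of_not_coprime h,
      coprimeInv_of_not_coprime fun h' => h ((coprime_mul_sub_iff hDM hax).1 h')]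
    ring

end CoprimeInv

/-- The sum of `1 / (i j k)` in `ZMod N`, over positive `i, j, k` prime to `D` with sum `n`. -/
def tripleSum (D N n : ℕ) : ZMod N :=
  ∑ t ∈ posTriples n, coprimeInv D N t.1 * coprimeInv D N t.2.1 * coprimeInv D N t.2.2

theorem sum_natTriples_linear {R : Type*} [CommRing R] (n : ℕ) (a b c : R) :
    ∑ t ∈ natTriples n, ((t.1 : R) * a + t.2.1 * b + t.2.2 * c) =
      (∑ t ∈ natTriples n, t.1 : ℕ) * (a + b + c) := by
  have h2 := sum_natTriples_swap₁₂ n (fun x _ _ => (x : R))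
  have h3 := sum_natTriples_swap₁₃ n (fun x _ _ => (x : R))
  simp only [Finset.sum_add_distrib, ← Finset.sum_mul]
  rw [← h2, ← h3]
  push_cast
  ring

theorem sum_posTriples_linear {R : Type*} [CommRing R] (n : ℕ) (a b c : R) :
    ∑ t ∈ posTriples n, ((t.1 : R) * a + t.2.1 * b + t.2.2 * c) =
      (∑ t ∈ posTriples n, t.1 : ℕ) * (a + b + c) := by
  have h2 := sum_posTriples_swap₁₂ n (fun x _ _ => (x : R))
  have h3 := sum_posTriples_swap₁₃ n (fun x _ _ => (x : R))
  simp only [Finset.sum_add_distrib, ← Finset.sum_mul]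
  rw [← h2, ← h3]
  push_cast
  ring

theorem le_mul_of_mem_posTriples {M L : ℕ} {t s : ℕ × ℕ × ℕ} (ht : t ∈ posTriples M)
    (hs : s ∈ posTriples L) : t.1 ≤ M * s.1 ∧ t.2.1 ≤ M * s.2.1 ∧ t.2.2 ≤ M * s.2.2 := by
  rw [mem_posTriples] at ht hs
  have h1 := Nat.le_mul_of_pos_right M hs.1
  have h2 := Nat.le_mul_of_pos_right M hs.2.1
  have h3 := Nat.le_mul_of_pos_right M hs.2.2.1
  omega

/-- Expand the lifted products to first order in M. The leading terms ±abc add up to (L+1)abc, while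
the linear terms have the same sign for both kinds of lift; symmetry in s replaces each coordinate
sum by that of the first coordinate. -/
theorem tripleSum_mul {D N M : ℕ} (L : ℕ) (hDN : ∀ i : ℕ, i.Coprime D → i.Coprime N) (hD : D ≠ 1)
    (hDM : D ∣ M) (h0 : 0 < M) (hM : (M : ZMod N) * M = 0) :
    tripleSum D N ((L + 1) * M) = (L + 1 : ℕ) * tripleSum D N M -
      M * (∑ s ∈ natTriples L, s.1 + ∑ s ∈ posTriples (L + 2), s.1 : ℕ) *
      ∑ t ∈ posTriples M, coprimeInv D N t.1 * coprimeInv D N t.2.1 * coprimeInv D N t.2.2 *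
        (coprimeInv D N t.1 + coprimeInv D N t.2.1 + coprimeInv D N t.2.2) := by
  unfold tripleSum
  rw [sum_posTriples_mul h0
    (fun i j k => coprimeInv D N i * coprimeInv D N j * coprimeInv D N k), Finset.mul_sum,
    Finset.mul_sum, ← Finset.sum_sub_distrib]
  · refine Finset.sum_congr rfl fun t ht => ?_
    set a := coprimeInv D N t.1 with ha
    set b := coprimeInv D N t.2.1 with hb
    set c := coprimeInv D N t.2.2 with hc
    have h1 : ∀ s ∈ natTriples L, coprimeInv D N (t.1 + M * s.1) *
        coprimeInv D N (t.2.1 + M * s.2.1) * coprimeInv D N (t.2.2 + M * s.2.2) =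
        a * b * c - M * (a * b * c) * (s.1 * a + s.2.1 * b + s.2.2 * c) := by
      intro s _
      rw [coprimeInv_add_mul hDN hDM hM, coprimeInv_add_mul hDN hDM hM,
        coprimeInv_add_mul hDN hDM hM, ← ha, ← hb, ← hc]
      linear_combination (a * b * c * (s.1 * s.2.1 * a * b + s.1 * s.2.2 * a * c
        + s.2.1 * s.2.2 * b * c) - M * s.1 * s.2.1 * s.2.2 * a ^ 2 * b ^ 2 * c ^ 2) * hM
    have h2 : ∀ s ∈ posTriples (L + 2), coprimeInv D N (M * s.1 - t.1) *
        coprimeInv D N (M * s.2.1 - t.2.1) * coprimeInv D N (M * s.2.2 - t.2.2) =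
        -(a * b * c) - M * (a * b * c) * (s.1 * a + s.2.1 * b + s.2.2 * c) := by
      intro s hs
      obtain ⟨l1, l2, l3⟩ := le_mul_of_mem_posTriples ht hs
      rw [coprimeInv_mul_sub hDN hDM hM l1, coprimeInv_mul_sub hDN hDM hM l2,
        coprimeInv_mul_sub hDN hDM hM l3, ← ha, ← hb, ← hc]
      linear_combination (-(a * b * c) * (s.1 * s.2.1 * a * b + s.1 * s.2.2 * a * c
        + s.2.1 * s.2.2 * b * c) - M * s.1 * s.2.1 * s.2.2 * a ^ 2 * b ^ 2 * c ^ 2) * hM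
    rw [Finset.sum_congr rfl h1, Finset.sum_congr rfl h2, Finset.sum_sub_distrib,
      Finset.sum_sub_distrib, Finset.sum_const, Finset.sum_const, ← Finset.mul_sum,
      ← Finset.mul_sum, sum_natTriples_linear, sum_posTriples_linear, card_natTriples_eq_add]
    simp only [nsmul_eq_mul]
    push_cast
    ring
  · intro i j k h
    rcases h with h | h | h <;> simp [coprimeInv_of_dvd hD hDM h]

theorem three_dvd_of_three_dvd_add {a b c : ℕ} (ha : ¬ 3 ∣ a) (hb : ¬ 3 ∣ b) (hc : ¬ 3 ∣ c)
    (h : 3 ∣ a + b + c) : 3 ∣ a * b + b * c + c * a := by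
  have : a % 3 = b % 3 ∧ b % 3 = c % 3 := by omega
  have ha' : a % 3 = 1 ∨ a % 3 = 2 := by omega
  apply Nat.dvd_of_mod_eq_zero
  rcases ha' with h' | h' <;>
    simp [Nat.add_mod, Nat.mul_mod, ← this.2, ← this.1, h']

/-- With M = p^(a+1) m one has M p = 0 in the ring, so it suffices to find one more factor p in the
linear correction of `tripleSum_mul`. -/
theorem tripleSum_prime_mul {p D a m : ℕ} (hp : p.Prime) (hp2 : p ≠ 2) (hpD : p ∣ D)
    (hm : 0 < m) (hDM : D ∣ p ^ (a + 1) * m) :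
    tripleSum D (p ^ (a + 2)) (p * (p ^ (a + 1) * m)) =
      p * tripleSum D (p ^ (a + 2)) (p ^ (a + 1) * m) := by
  have hDp : ∀ i : ℕ, i.Coprime D → i.Coprime p := fun i h => h.coprime_dvd_right hpD
  have hDN : ∀ i : ℕ, i.Coprime D → i.Coprime (p ^ (a + 2)) := fun i h =>
    Nat.Coprime.pow_right _ (hDp i h)
  have hD : D ≠ 1 := by
    rintro rfl; exact hp.one_lt.ne' (Nat.dvd_one.1 hpD)
  have h0 : 0 < p ^ (a + 1) * m := Nat.mul_pos (pow_pos hp.pos _) hm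
  have hpM : ((p ^ (a + 1) * m : ℕ) : ZMod (p ^ (a + 2))) * p = 0 := by
    rw [← Nat.cast_mul, ZMod.natCast_eq_zero_iff]
    exact ⟨m, by ring⟩
  have hM : ((p ^ (a + 1) * m : ℕ) : ZMod (p ^ (a + 2))) * (p ^ (a + 1) * m : ℕ) = 0 := by
    rw [← Nat.cast_mul, ZMod.natCast_eq_zero_iff]
    exact ⟨p ^ a * m * m, by ring⟩
  obtain ⟨L, rfl⟩ : ∃ L, p = L + 1 := ⟨p - 1, by have := hp.pos; omega⟩
  rw [tripleSum_mul L hDN hD hDM h0 hM, sub_eq_self]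
  set M := (L + 1) ^ (a + 1) * m with hMdef
  -- For p = 3 the factor 3 sits in 1/i + 1/j + 1/k = (ij + jk + ki)/(ijk), as i, j, k are congruent
  -- modulo 3. For p > 3 it sits in the coordinate sums of s, computed from cardinalities divisible
  -- by p.
  by_cases h3 : L + 1 = 3
  · rw [mul_right_comm, Finset.mul_sum]
    convert zero_mul _
    refine Finset.sum_eq_zero fun t ht => ?_
    by_cases hco : t.1.Coprime D ∧ t.2.1.Coprime D ∧ t.2.2.Coprime D
    · obtain ⟨c1, c2, c3⟩ := hco
      have e1 := coprimeInv_mul_cast hDN c1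
      have e2 := coprimeInv_mul_cast hDN c2
      have e3 := coprimeInv_mul_cast hDN c3
      have hnd : ∀ i : ℕ, i.Coprime D → ¬ 3 ∣ i := fun i hi hd => by
        have := Nat.eq_one_of_dvd_coprimes (hDp i hi) (h3 ▸ hd) dvd_rfl
        omega
      have hs : 3 ∣ t.1 + t.2.1 + t.2.2 := by
        rw [(mem_posTriples.1 ht).2.2.2, hMdef, h3]
        exact (dvd_pow_self 3 (by omega)).mul_right m
      obtain ⟨k, hk⟩ := three_dvd_of_three_dvd_add (hnd _ c1) (hnd _ c2) (hnd _ c3) hs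
      have hk' : (t.1 * t.2.1 + t.2.1 * t.2.2 + t.2.2 * t.1 : ZMod ((L + 1) ^ (a + 2))) =
          (L + 1 : ℕ) * k := by
        rw [← h3] at hk; exact_mod_cast congrArg (Nat.cast (R := ZMod ((L + 1) ^ (a + 2)))) hk
      set u := coprimeInv D ((L + 1) ^ (a + 2)) t.1
      set v := coprimeInv D ((L + 1) ^ (a + 2)) t.2.1
      set w := coprimeInv D ((L + 1) ^ (a + 2)) t.2.2
      linear_combination (u * v * w) ^ 2 * k * hpM + M * (u * v * w) ^ 2 * hk'
        - M * u * v * w * (w * (v * t.2.1 * e1 + e2) + u * (w * t.2.2 * e2 + e3)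
          + v * (u * t.1 * e3 + e1))
    · rcases not_and_or.1 hco with h | h
      · simp [coprimeInv_of_not_coprime h]
      · rcases not_and_or.1 h with h | h <;> simp [coprimeInv_of_not_coprime h]
  · have h2 : ¬ (L + 1) ∣ 2 := fun h => by
      have := Nat.le_of_dvd (by norm_num) h
      have := hp.two_le; omega
    have c1 : L + 1 ∣ (natTriples L).card :=
      (hp.dvd_mul.1 (Dvd.intro _ (card_natTriples L).symm)).resolve_left h2
    have c2 : L + 1 ∣ (posTriples (L + 2)).card :=
      (hp.dvd_mul.1 (Dvd.intro_left _ (card_posTriples L).symm)).resolve_left h2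
    have hdvd : L + 1 ∣ ∑ s ∈ natTriples L, s.1 + ∑ s ∈ posTriples (L + 2), s.1 := by
      have h3' : ¬ (L + 1) ∣ 3 := fun h => by
        rcases (Nat.dvd_prime Nat.prime_three).1 h with h | h
        · have := hp.two_le; omega
        · exact h3 h
      refine (hp.dvd_mul.1 (?_ : L + 1 ∣ 3 * _)).resolve_left h3'
      rw [mul_add, three_mul_sum_natTriples_fst, three_mul_sum_posTriples_fst]
      exact (c1.mul_left _).add (c2.mul_left _)
    obtain ⟨k, hk⟩ := hdvd
    rw [hk]
    push_cast at hpM ⊢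
    simp only [← mul_assoc, hpM, zero_mul]

/-! ### The alternating sum by parity classes -/

/-- The sum of `(-1) ^ i / (i j k)` in `ZMod N`, over positive `i, j, k` prime to `D` with
sum `n`. -/
def alternatingTripleSum (D N n : ℕ) : ZMod N :=
  ∑ t ∈ posTriples n,
    (-1) ^ t.1 * (coprimeInv D N t.1 * coprimeInv D N t.2.1 * coprimeInv D N t.2.2)

theorem coprimeInv_two_mul {D N : ℕ} (hDN : ∀ i : ℕ, i.Coprime D → i.Coprime N)
    (h2 : Nat.Coprime 2 D) (i : ℕ) :
    coprimeInv D N (2 * i) * 2 = coprimeInv D N i := by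
  by_cases h : i.Coprime D
  · have h' : (2 * i).Coprime D := h2.mul_left h
    have e := coprimeInv_mul_cast hDN h'
    refine (coprimeInv_eq_of_mul_cast hDN h ?_).symm
    push_cast at e
    linear_combination e
  · rw [coprimeInv_of_not_coprime h, coprimeInv_of_not_coprime fun h' => h h'.coprime_mul_left,
      zero_mul]

theorem sum_posTriples_dvd {R : Type*} [AddCommMonoid R] {q : ℕ} (hq : 0 < q) (n : ℕ)
    (f : ℕ → ℕ → ℕ → R) :
    ∑ t ∈ posTriples (q * n),
      (if q ∣ t.1 ∧ q ∣ t.2.1 ∧ q ∣ t.2.2 then f t.1 t.2.1 t.2.2 else 0) =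
      ∑ t ∈ posTriples n, f (q * t.1) (q * t.2.1) (q * t.2.2) := by
  rw [← Finset.sum_filter]
  symm
  refine Finset.sum_nbij (fun t => (q * t.1, q * t.2.1, q * t.2.2)) ?_ ?_ ?_ ?_
  · intro t
    simp only [Finset.mem_filter, mem_posTriples, dvd_mul_right, and_self, and_true]
    rintro ⟨h1, h2, h3, rfl⟩
    exact ⟨Nat.mul_pos hq h1, Nat.mul_pos hq h2, Nat.mul_pos hq h3, by ring⟩
  · rintro ⟨a, b, c⟩ _ ⟨a', b', c'⟩ _ h
    simpa only [Prod.mk.injEq, Nat.mul_left_cancel_iff hq] using h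
  · rintro ⟨i, j, k⟩ h
    simp only [Finset.coe_filter, Set.mem_ofPred_eq, mem_posTriples] at h
    obtain ⟨⟨h1, h2, h3, h⟩, ⟨a, rfl⟩, ⟨b, rfl⟩, ⟨c, rfl⟩⟩ := h
    refine ⟨(a, b, c), ?_, rfl⟩
    rw [Finset.mem_coe, mem_posTriples]
    refine ⟨Nat.pos_of_mul_pos_left h1, Nat.pos_of_mul_pos_left h2,
      Nat.pos_of_mul_pos_left h3, Nat.eq_of_mul_eq_mul_left hq ?_⟩
    linear_combination h
  · intro t _; rfl

/-- Three relations, Z = O + 3E, S = E − O and Z = 8(3E − O), give 3(4S + Z) = 0. Assuming only 3n =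
0 instead of n = 0 allows the modulus to be one power of 3 higher when p = 3. -/
theorem three_mul_alternatingTripleSum {D N n : ℕ} (hDN : ∀ i : ℕ, i.Coprime D → i.Coprime N)
    (hD : D ≠ 1) (hDn : D ∣ n) (hn : Odd n) (hM : (n : ZMod N) * n = 0)
    (h3 : 3 * (n : ZMod N) = 0) :
    3 * (4 * alternatingTripleSum D N n + tripleSum D N n) = 0 := by
  set u := coprimeInv D N with hu
  have h0 : 0 < n := hn.pos
  have h2D : Nat.Coprime 2 D := Nat.Coprime.coprime_dvd_right hDn hn.coprime_two_left
  -- `O` collects the triples of odd numbers, `E` those of parity (odd, even, even)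
  set o : ℕ → ℕ → ℕ → ZMod N := fun a b c =>
    if ¬Even a ∧ ¬Even b ∧ ¬Even c then u a * u b * u c else 0 with ho
  set e : ℕ → ℕ → ℕ → ZMod N := fun a b c =>
    if ¬Even a ∧ Even b ∧ Even c then u a * u b * u c else 0 with he
  set O := ∑ t ∈ posTriples n, o t.1 t.2.1 t.2.2 with hO
  set E := ∑ t ∈ posTriples n, e t.1 t.2.1 t.2.2 with hE
  have hE₂ : ∑ t ∈ posTriples n, e t.2.1 t.1 t.2.2 = E := (sum_posTriples_swap₁₂ n e).symm
  have hE₃ : ∑ t ∈ posTriples n, e t.2.2 t.2.1 t.1 = E := (sum_posTriples_swap₁₃ n e).symm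
  have hpar : ∀ t ∈ posTriples n, (Even t.1 ∧ Even t.2.1 ∧ ¬Even t.2.2) ∨
      (Even t.1 ∧ ¬Even t.2.1 ∧ Even t.2.2) ∨ (¬Even t.1 ∧ Even t.2.1 ∧ Even t.2.2) ∨
      (¬Even t.1 ∧ ¬Even t.2.1 ∧ ¬Even t.2.2) := by
    intro t ht
    have hs := (mem_posTriples.1 ht).2.2.2
    rw [← hs, ← Nat.not_even_iff_odd, Nat.even_add, Nat.even_add] at hn
    tauto
  have hZ : tripleSum D N n = O + 3 * E := by
    have : tripleSum D N n = O + (E + ∑ t ∈ posTriples n, e t.2.1 t.1 t.2.2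
        + ∑ t ∈ posTriples n, e t.2.2 t.2.1 t.1) := by
      rw [tripleSum, hO, hE, ← Finset.sum_add_distrib, ← Finset.sum_add_distrib,
        ← Finset.sum_add_distrib]
      refine Finset.sum_congr rfl fun t ht => ?_
      rcases hpar t ht with ⟨h1, h2, h3⟩ | ⟨h1, h2, h3⟩ | ⟨h1, h2, h3⟩ | ⟨h1, h2, h3⟩ <;>
        simp only [ho, he, ← hu, h1, h2, h3, not_true_eq_false, not_false_eq_true, and_self,
          and_true, and_false, if_true, if_false] <;> ring
    rw [this, hE₂, hE₃]; ring
  have hS : alternatingTripleSum D N n = E - O := by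
    have : alternatingTripleSum D N n = ∑ t ∈ posTriples n, e t.2.1 t.1 t.2.2
        + ∑ t ∈ posTriples n, e t.2.2 t.2.1 t.1 - E - O := by
      rw [alternatingTripleSum, hO, hE, ← Finset.sum_add_distrib, ← Finset.sum_sub_distrib,
        ← Finset.sum_sub_distrib]
      refine Finset.sum_congr rfl fun t ht => ?_
      rcases hpar t ht with ⟨h1, h2, h3⟩ | ⟨h1, h2, h3⟩ | ⟨h1, h2, h3⟩ | ⟨h1, h2, h3⟩ <;>
        simp only [neg_one_pow_eq_ite, ho, he, ← hu, h1, h2, h3, not_true_eq_false,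
          not_false_eq_true, and_self, and_true, and_false, if_true,
          if_false] <;> ring
    rw [this, hE₂, hE₃]; ring
  -- Doubling the entries identifies triples of sum n with all-even triples of sum 2n, and divides
  -- each term by 8.
  have hdouble : tripleSum D N n = 8 * ∑ t ∈ posTriples (2 * n),
      (if Even t.1 ∧ Even t.2.1 ∧ Even t.2.2 then u t.1 * u t.2.1 * u t.2.2 else 0) := by
    simp only [even_iff_two_dvd]
    rw [sum_posTriples_dvd two_pos n (fun a b c => u a * u b * u c), Finset.mul_sum, tripleSum]
    refine Finset.sum_congr rfl fun t _ => ?_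
    rw [← coprimeInv_two_mul hDN h2D t.1, ← coprimeInv_two_mul hDN h2D t.2.1,
      ← coprimeInv_two_mul hDN h2D t.2.2]
    ring
  -- As n is odd, adding n to one entry gives an all-even triple exactly when that entry alone is
  -- odd, and n − t is all even exactly when t is all odd. The corrections linear in n occur three
  -- times by symmetry and die by 3n = 0.
  have hlift : ∑ t ∈ posTriples (2 * n),
      (if Even t.1 ∧ Even t.2.1 ∧ Even t.2.2 then u t.1 * u t.2.1 * u t.2.2 else 0) =
      3 * E - O := by
    rw [show 2 * n = (1 + 1) * n by ring, sum_posTriples_mul h0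
      (fun a b c => if Even a ∧ Even b ∧ Even c then u a * u b * u c else 0)]
    · set g : ℕ → ℕ → ℕ → ZMod N := fun a b c => e a b c * (1 - n * u a) with hg
      set k : ℕ → ℕ → ℕ → ZMod N := fun a b c => o a b c * u a with hk
      have hg₂ := sum_posTriples_swap₁₂ n g
      have hg₃ := sum_posTriples_swap₁₃ n g
      have hk₂ := sum_posTriples_swap₁₂ n k
      have hk₃ := sum_posTriples_swap₁₃ n k
      have hgE : 3 * ∑ t ∈ posTriples n, g t.1 t.2.1 t.2.2 = 3 * E := by
        rw [hE, Finset.mul_sum, Finset.mul_sum]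
        refine Finset.sum_congr rfl fun t _ => ?_
        simp only [hg]
        linear_combination -(e t.1 t.2.1 t.2.2 * u t.1) * h3
      have hsum : ∑ t ∈ posTriples n, (g t.1 t.2.1 t.2.2 + g t.2.1 t.1 t.2.2 + g t.2.2 t.2.1 t.1
          - o t.1 t.2.1 t.2.2 - n * (k t.1 t.2.1 t.2.2 + k t.2.1 t.1 t.2.2 + k t.2.2 t.2.1 t.1)) =
          3 * E - O := by
        rw [Finset.sum_sub_distrib, Finset.sum_sub_distrib, Finset.sum_add_distrib,
          Finset.sum_add_distrib, ← hg₂, ← hg₃, ← Finset.mul_sum, Finset.sum_add_distrib,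
          Finset.sum_add_distrib, ← hk₂, ← hk₃, ← hO, ← hgE]
        linear_combination -(∑ t ∈ posTriples n, k t.1 t.2.1 t.2.2) * h3
      rw [← hsum]
      refine Finset.sum_congr rfl fun t ht => ?_
      obtain ⟨p1, p2, p3, hs⟩ := mem_posTriples.1 ht
      have l1 : t.1 ≤ n := by omega
      have l2 : t.2.1 ≤ n := by omega
      have l3 : t.2.2 ≤ n := by omega
      have A : ∀ a, u (a + n) = u a - n * u a ^ 2 := fun a => by
        simpa using coprimeInv_add_mul hDN hDn hM a 1
      have S : ∀ a, a ≤ n → u (n - a) = -u a - n * u a ^ 2 := fun a ha => by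
        simpa using coprimeInv_mul_sub hDN hDn hM (a := a) (x := 1) (by simpa)
      have hn' : ¬ Even n := Nat.not_even_iff_odd.2 hn
      rw [show natTriples 1 = {(1, 0, 0), (0, 1, 0), (0, 0, 1)} by decide,
        show posTriples (1 + 2) = {(1, 1, 1)} by decide]
      rw [Finset.sum_insert (by decide), Finset.sum_insert (by decide), Finset.sum_singleton,
        Finset.sum_singleton]
      simp only [mul_one, mul_zero, add_zero, A, S _ l1, S _ l2, S _ l3, Nat.even_add, hn',
        Nat.even_sub l1, Nat.even_sub l2, Nat.even_sub l3, hg, hk, he, ho, iff_false, false_iff]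
      set a := u t.1
      set b := u t.2.1
      set c := u t.2.2
      have hodd : (-a - n * a ^ 2) * (-b - n * b ^ 2) * (-c - n * c ^ 2) =
          -(a * b * c) - n * (a * b * c * a + b * a * c * b + c * b * a * c) := by
        linear_combination (-(a * b * c) * (a * b + a * c + b * c) - n * a ^ 2 * b ^ 2 * c ^ 2) * hM
      rw [hodd]
      rcases hpar t ht with ⟨h1, h2, h3⟩ | ⟨h1, h2, h3⟩ | ⟨h1, h2, h3⟩ | ⟨h1, h2, h3⟩ <;>
        simp only [h1, h2, h3, not_true_eq_false, not_false_eq_true, and_self, and_true, 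
          and_false, if_true, if_false] <;> ring
    · intro i j k h
      rcases h with h | h | h <;> simp [hu, coprimeInv_of_dvd hD hDn h]
  rw [hlift] at hdouble
  rw [hS]
  linear_combination 4 * hZ - hdouble

/-! ### Carries and lifts divisible by q -/

/-- The least `x` with `q ∣ a + p * x`, for `q` prime to `p`. -/
def carry (p q a : ℕ) : ℕ := (-(a : ZMod q) * (p : ZMod q)⁻¹).val

section Carry

variable {p q : ℕ}

theorem dvd_add_mul_iff (hpq : p.Coprime q) {a x : ℕ} (hx : x < q) :
    q ∣ a + p * x ↔ x = carry p q a := by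
  have hq : NeZero q := ⟨by omega⟩
  have hu := ZMod.coe_mul_inv_eq_one p hpq
  rw [← ZMod.natCast_eq_zero_iff, carry]
  push_cast
  constructor
  · intro h
    have : (x : ZMod q) = -(a : ZMod q) * (p : ZMod q)⁻¹ := by
      linear_combination (p : ZMod q)⁻¹ * h - x * hu
    rw [← this, ZMod.val_cast_of_lt hx]
  · intro h
    have : (x : ZMod q) = -(a : ZMod q) * (p : ZMod q)⁻¹ := by
      rw [h, ZMod.natCast_zmod_val]
    rw [this]
    linear_combination -a * hu

theorem carry_lt (hq : 0 < q) (a : ℕ) : carry p q a < q := by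
  have : NeZero q := ⟨hq.ne'⟩
  exact ZMod.val_lt _

theorem dvd_add_mul_carry (hpq : p.Coprime q) (hq : 0 < q) (a : ℕ) : q ∣ a + p * carry p q a :=
  (dvd_add_mul_iff hpq (carry_lt hq a)).2 rfl

/-- The numbers a + p x and (p − a) + p(q − 1 − x) add up to pq, so q divides both or neither. -/
theorem carry_sub (hpq : p.Coprime q) (hq : 0 < q) {a : ℕ} (ha : a ≤ p) :
    carry p q (p - a) = q - 1 - carry p q a := by
  symm
  rw [← dvd_add_mul_iff hpq (by omega)]
  have h1 := carry_lt (p := p) hq a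
  have h2 := dvd_add_mul_carry hpq hq a
  have h3 : (p - a + p * (q - 1 - carry p q a)) + (a + p * carry p q a) = p * q := by
    zify [ha, show 1 ≤ q from hq, show carry p q a ≤ q - 1 by omega]
    ring
  exact (Nat.dvd_add_left h2).1 (h3 ▸ Nat.dvd_mul_left q p)

theorem sum_dvd_add_mul {R : Type*} [AddCommMonoid R] (hpq : p.Coprime q) (hq : 0 < q) (a r : ℕ)
    (g : ℕ → R) :
    ∑ x ∈ Finset.range (q * r), (if q ∣ a + p * x then g x else 0) =
      ∑ t ∈ Finset.range r, g (q * t + carry p q a) := by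
  induction r with
  | zero => simp
  | succ r ih =>
    rw [mul_add, mul_one, Finset.sum_range_add, ih, Finset.sum_range_succ]
    congr 1
    rw [Finset.sum_eq_single (carry p q a)]
    · rw [if_pos]
      rw [mul_add, ← add_assoc, add_right_comm]
      exact (dvd_add_mul_carry hpq hq a).add ((Dvd.intro _ rfl).mul_left p)
    · intro y hy hne
      rw [if_neg]
      intro h
      apply hne
      rw [← dvd_add_mul_iff hpq (Finset.mem_range.1 hy)]
      rw [mul_add, ← add_assoc, add_right_comm] at h
      exact (Nat.dvd_add_left ((Dvd.intro r rfl).mul_left p)).1 h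
    · intro h
      exact absurd (Finset.mem_range.2 (carry_lt hq a)) h

end Carry

theorem sum_natTriples_fst {R : Type*} [CommRing R] (n : ℕ) (g : ℕ → R) :
    ∑ t ∈ natTriples n, g t.1 = ∑ x ∈ Finset.range (n + 1), ((n + 1 : ℕ) - x : R) * g x := by
  rw [sum_natTriples_eq n (fun x _ _ => g x)]
  refine Finset.sum_congr rfl fun x hx => ?_
  rw [Finset.mem_range] at hx
  rw [Finset.sum_const, Finset.card_range, nsmul_eq_mul, Nat.cast_sub hx.le]

theorem sum_posTriples_fst {R : Type*} [CommRing R] (n : ℕ) (g : ℕ → R) :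
    ∑ t ∈ posTriples (n + 2), g t.1 = ∑ x ∈ Finset.range (n + 1), (x : R) * g (n + 1 - x) := by
  rw [sum_posTriples_eq (n + 2) (fun x _ _ => g x), Finset.sum_Ico_eq_sum_range,
    ← Finset.sum_range_reflect]
  refine Finset.sum_congr rfl fun x hx => ?_
  rw [Finset.mem_range] at hx
  rw [Finset.sum_const, Nat.card_Ico, nsmul_eq_mul]
  congr 2 <;> omega

/-- Signed count of the lifts whose first entry is divisible by q. Grouping by the first coordinate
and reflecting the second sum, it becomes ∑ (qr − 2x) over x < qr with q ∣ a + p x, that is, over x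
= qt + c with c the carry and t < r. -/
theorem sum_natTriples_dvd_sub_sum_posTriples_dvd {R : Type*} [CommRing R] {p q a L r : ℕ}
    (hpq : p.Coprime q) (hq : 0 < q) (hL : L + 1 = q * r) (ha : a ≤ p) :
    ∑ s ∈ natTriples L, (if q ∣ a + p * s.1 then (1 : R) else 0) -
      ∑ s ∈ posTriples (L + 2), (if q ∣ p * s.1 - a then (1 : R) else 0) =
      r * (q - 2 * carry p q a) := by
  rw [sum_natTriples_fst L (fun x => if q ∣ a + p * x then (1 : R) else 0),
    sum_posTriples_fst L (fun x => if q ∣ p * x - a then (1 : R) else 0),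
    ← Finset.sum_sub_distrib]
  have h1 : ∀ x ∈ Finset.range (L + 1),
      ((L + 1 : ℕ) - x : R) * (if q ∣ a + p * x then (1 : R) else 0) -
        x * (if q ∣ p * (L + 1 - x) - a then (1 : R) else 0) =
      if q ∣ a + p * x then ((L + 1 : ℕ) - 2 * x : R) else 0 := by
    intro x hx
    rw [Finset.mem_range] at hx
    have hle : a ≤ p * (L + 1 - x) := ha.trans (Nat.le_mul_of_pos_right p (by omega))
    have hsum : (p * (L + 1 - x) - a) + (a + p * x) = p * (L + 1) := by
      zify [hle, hx.le]; ring
    have hiff : q ∣ p * (L + 1 - x) - a ↔ q ∣ a + p * x := by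
      have hd : q ∣ (p * (L + 1 - x) - a) + (a + p * x) := by
        rw [hsum, hL]; exact (Dvd.intro r rfl).mul_left p
      exact ⟨fun h => (Nat.dvd_add_right h).1 hd, fun h => (Nat.dvd_add_left h).1 hd⟩
    simp only [hiff]
    split_ifs <;> ring
  rw [Finset.sum_congr rfl h1, hL,
    sum_dvd_add_mul hpq hq a r (fun x => ((q * r : ℕ) - 2 * x : R))]
  have h2 : (∑ t ∈ Finset.range r, (t : R)) * 2 = r * r - r := by
    rw [← Nat.cast_sum]
    cases r with
    | zero => simp
    | succ r =>
      have := Finset.sum_range_id_mul_two (r + 1)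
      rw [Nat.add_sub_cancel] at this
      have h := congrArg (Nat.cast (R := R)) this
      push_cast at h ⊢
      linear_combination h
  simp only [Finset.sum_sub_distrib, Finset.sum_const, Finset.card_range, nsmul_eq_mul,
    ← Finset.mul_sum, Nat.cast_add, Nat.cast_mul, Finset.sum_add_distrib]
  linear_combination -(q : R) * h2

/-! ### Reduction of the sum modulo p to T and the carry sum -/

section ModPrime

variable {p : ℕ} [hp : Fact p.Prime]

theorem coprimeInv_prime (i : ℕ) : coprimeInv p p i = (i : ZMod p)⁻¹ := by
  by_cases h : i.Coprime p
  · rw [coprimeInv, if_pos h]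
  · rw [coprimeInv_of_not_coprime h, (ZMod.natCast_eq_zero_iff i p).2, inv_zero]
    by_contra h'
    exact h ((hp.out.coprime_iff_not_dvd.2 h').symm)

theorem tripleSum_prime (n : ℕ) : tripleSum p p n =
    ∑ t ∈ posTriples n, (t.1 : ZMod p)⁻¹ * (t.2.1 : ZMod p)⁻¹ * (t.2.2 : ZMod p)⁻¹ := by
  simp only [tripleSum, coprimeInv_prime]

theorem tripleSum_prime_mul_right {m : ℕ} (hm : 0 < m) :
    tripleSum p p (m * p) = m * tripleSum p p p := by
  obtain ⟨L, rfl⟩ : ∃ L, m = L + 1 := ⟨m - 1, by omega⟩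
  rw [tripleSum_mul L (fun _ h => h) hp.out.one_lt.ne' dvd_rfl hp.out.pos (by simp)]
  simp

/-- The sum of `carry p q a / (a b c)` modulo `p` over positive `a, b, c` with sum `p`. -/
def carryTripleSum (p q : ℕ) : ZMod p :=
  ∑ t ∈ posTriples p,
    carry p q t.1 * ((t.1 : ZMod p)⁻¹ * (t.2.1 : ZMod p)⁻¹ * (t.2.2 : ZMod p)⁻¹)

theorem sum_posTriples_dvd_fst {q r : ℕ} (hpq : p.Coprime q) (hq : 0 < q) (hr : 0 < r) :
    ∑ t ∈ posTriples (q * r * p), (if q ∣ t.1 then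
      (t.1 : ZMod p)⁻¹ * (t.2.1 : ZMod p)⁻¹ * (t.2.2 : ZMod p)⁻¹ else 0) =
      r * (q * tripleSum p p p - 2 * carryTripleSum p q) := by
  obtain ⟨L, hL⟩ : ∃ L, L + 1 = q * r := ⟨q * r - 1, by have := Nat.mul_pos hq hr; omega⟩
  rw [← hL, sum_posTriples_mul hp.out.pos (fun i j k => if q ∣ i then
      (i : ZMod p)⁻¹ * (j : ZMod p)⁻¹ * (k : ZMod p)⁻¹ else 0)]
  · rw [tripleSum_prime, carryTripleSum, Finset.mul_sum, Finset.mul_sum, ← Finset.sum_sub_distrib,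
      Finset.mul_sum]
    refine Finset.sum_congr rfl fun t ht => ?_
    have ha : t.1 ≤ p := by rw [mem_posTriples] at ht; omega
    have key := sum_natTriples_dvd_sub_sum_posTriples_dvd (R := ZMod p) hpq hq hL ha
    set W := (t.1 : ZMod p)⁻¹ * (t.2.1 : ZMod p)⁻¹ * (t.2.2 : ZMod p)⁻¹ with hW
    have h1 : ∀ s ∈ posTriples (L + 2), (if q ∣ p * s.1 - t.1 then
        ((p * s.1 - t.1 : ℕ) : ZMod p)⁻¹ * ((p * s.2.1 - t.2.1 : ℕ) : ZMod p)⁻¹ *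
          ((p * s.2.2 - t.2.2 : ℕ) : ZMod p)⁻¹ else 0) =
        -W * (if q ∣ p * s.1 - t.1 then 1 else 0) := by
      intro s hs
      obtain ⟨l1, l2, l3⟩ := le_mul_of_mem_posTriples ht hs
      push_cast [l1, l2, l3]
      simp only [CharP.cast_eq_zero, zero_mul, zero_sub, inv_neg]
      split_ifs
      · rw [hW]; ring
      · ring
    have h2 : ∀ s ∈ natTriples L, (if q ∣ t.1 + p * s.1 then
        ((t.1 + p * s.1 : ℕ) : ZMod p)⁻¹ * ((t.2.1 + p * s.2.1 : ℕ) : ZMod p)⁻¹ *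
          ((t.2.2 + p * s.2.2 : ℕ) : ZMod p)⁻¹ else 0) =
        W * (if q ∣ t.1 + p * s.1 then 1 else 0) := by
      intro s _
      push_cast
      simp only [CharP.cast_eq_zero, zero_mul, add_zero]
      split_ifs
      · rw [hW]; ring
      · ring
    rw [Finset.sum_congr rfl h1, Finset.sum_congr rfl h2, ← Finset.mul_sum, ← Finset.mul_sum]
    linear_combination W * key
  · intro i j k h
    rcases h with h | h | h <;> simp [(ZMod.natCast_eq_zero_iff _ p).2 h]

/-- Inclusion–exclusion over the entries divisible by q. As q divides the total, two divisible
entries force the third, so the pairwise and triple terms combine into 3 − 1 = 2 times the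
all-divisible sum. -/
theorem tripleSum_mul_prime {q r : ℕ} (hq : q.Prime) (hpq : p ≠ q) (hr : 0 < r) :
    tripleSum (p * q) p (q * r * p) = q * r * tripleSum p p p
      - 3 * (r * (q * tripleSum p p p - 2 * carryTripleSum p q))
      + 2 * ((q : ZMod p)⁻¹ ^ 3 * (r * tripleSum p p p)) := by
  have hco : p.Coprime q := (Nat.coprime_primes hp.out hq).2 hpq
  set f : ℕ → ℕ → ℕ → ZMod p := fun i j k => if q ∣ i then
    (i : ZMod p)⁻¹ * (j : ZMod p)⁻¹ * (k : ZMod p)⁻¹ else 0 with hf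
  have e1 : ∑ t ∈ posTriples (q * r * p), f t.1 t.2.1 t.2.2 =
      r * (q * tripleSum p p p - 2 * carryTripleSum p q) := sum_posTriples_dvd_fst hco hq.pos hr
  have e2 := (sum_posTriples_swap₁₂ (q * r * p) f).symm.trans e1
  have e3 := (sum_posTriples_swap₁₃ (q * r * p) f).symm.trans e1
  have e0 := tripleSum_prime_mul_right (p := p) (Nat.mul_pos hq.pos hr)
  have e4 : ∑ t ∈ posTriples (q * r * p), (if q ∣ t.1 ∧ q ∣ t.2.1 ∧ q ∣ t.2.2 then
      (t.1 : ZMod p)⁻¹ * (t.2.1 : ZMod p)⁻¹ * (t.2.2 : ZMod p)⁻¹ else 0) =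
      (q : ZMod p)⁻¹ ^ 3 * (r * tripleSum p p p) := by
    rw [mul_assoc q, sum_posTriples_dvd hq.pos (r * p) (fun i j k =>
      (i : ZMod p)⁻¹ * (j : ZMod p)⁻¹ * (k : ZMod p)⁻¹), ← tripleSum_prime_mul_right hr,
      tripleSum_prime, Finset.mul_sum]
    refine Finset.sum_congr rfl fun t _ => ?_
    push_cast
    rw [mul_inv, mul_inv, mul_inv]
    ring
  have hinv : ∀ i : ℕ, coprimeInv (p * q) p i = if q ∣ i then 0 else (i : ZMod p)⁻¹ := by
    intro i
    split_ifs with h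
    · apply coprimeInv_of_not_coprime
      intro h'
      exact Nat.not_coprime_of_dvd_of_dvd hq.one_lt h (Nat.dvd_mul_left q p) h'
    · have : i.Coprime q := ((hq.coprime_iff_not_dvd).2 h).symm
      rw [← coprimeInv_prime]
      exact if_congr (Nat.coprime_mul_iff_right.trans (and_iff_left this)) rfl rfl
  have key : tripleSum (p * q) p (q * r * p) = tripleSum p p (q * r * p)
      - (∑ t ∈ posTriples (q * r * p), f t.1 t.2.1 t.2.2
        + ∑ t ∈ posTriples (q * r * p), f t.2.1 t.1 t.2.2
        + ∑ t ∈ posTriples (q * r * p), f t.2.2 t.2.1 t.1)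
      + 2 * ∑ t ∈ posTriples (q * r * p), (if q ∣ t.1 ∧ q ∣ t.2.1 ∧ q ∣ t.2.2 then
      (t.1 : ZMod p)⁻¹ * (t.2.1 : ZMod p)⁻¹ * (t.2.2 : ZMod p)⁻¹ else 0) := by
    rw [tripleSum_prime, tripleSum, Finset.mul_sum, ← Finset.sum_add_distrib,
      ← Finset.sum_add_distrib, ← Finset.sum_sub_distrib, ← Finset.sum_add_distrib]
    refine Finset.sum_congr rfl fun t ht => ?_
    have hd : q ∣ t.1 + t.2.1 + t.2.2 := by
      rw [(mem_posTriples.1 ht).2.2.2, mul_assoc]; exact Dvd.intro _ rfl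
    have h12 : q ∣ t.1 → q ∣ t.2.1 → q ∣ t.2.2 := fun h h' => (Nat.dvd_add_right (h.add h')).1 hd
    have h13 : q ∣ t.1 → q ∣ t.2.2 → q ∣ t.2.1 := fun h h' =>
      (Nat.dvd_add_right h).1 ((Nat.dvd_add_left h').1 hd)
    have h23 : q ∣ t.2.1 → q ∣ t.2.2 → q ∣ t.1 := fun h h' =>
      (Nat.dvd_add_left h).1 ((Nat.dvd_add_left h').1 hd)
    simp only [hinv, hf]
    by_cases d1 : q ∣ t.1 <;> by_cases d2 : q ∣ t.2.1 <;> by_cases d3 : q ∣ t.2.2 <;>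
      simp only [d1, d2, d3, if_true, if_false, and_self, and_true, and_false,
        forall_true_left, imp_false, not_true_eq_false] at h12 h13 h23 ⊢ <;> ring
  rw [key, e0, e1, e2, e3, e4]
  push_cast
  ring

end ModPrime

/-! ### Partial fractions and harmonic numbers modulo p -/

section PartialFractions

variable {p : ℕ} [hp : Fact p.Prime]

theorem sum_Ico_flip {R : Type*} [AddCommMonoid R] (n : ℕ) (f : ℕ → R) :
    ∑ a ∈ Finset.Ico 1 n, f (n - a) = ∑ a ∈ Finset.Ico 1 n, f a := by
  rw [Finset.sum_Ico_reflect f 1 (Nat.le_succ n)]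
  simp

theorem cast_sub_prime {a : ℕ} (ha : a ≤ p) : ((p - a : ℕ) : ZMod p) = -(a : ZMod p) := by
  rw [Nat.cast_sub ha]; simp

theorem natCast_ne_zero_of_mem_Ico {a : ℕ} (ha : a ∈ Finset.Ico 1 p) : (a : ZMod p) ≠ 0 := by
  rw [Finset.mem_Ico] at ha
  rw [Ne, ZMod.natCast_eq_zero_iff]
  exact Nat.not_dvd_of_pos_of_lt ha.1 ha.2

/-- The harmonic number `1 + 1 / 2 + ⋯ + 1 / (n - 1)` modulo `p`. -/
def harmonicMod (p n : ℕ) : ZMod p := ∑ b ∈ Finset.Ico 1 n, (b : ZMod p)⁻¹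

theorem harmonicMod_succ {n : ℕ} (hn : 1 ≤ n) :
    harmonicMod p (n + 1) = harmonicMod p n + (n : ZMod p)⁻¹ :=
  Finset.sum_Ico_succ_top hn _

theorem two_ne_zero_zmod (hp2 : p ≠ 2) : (2 : ZMod p) ≠ 0 := by
  have : ((2 : ℕ) : ZMod p) ≠ 0 := by
    rw [Ne, ZMod.natCast_eq_zero_iff, Nat.prime_dvd_prime_iff_eq hp.out Nat.prime_two]
    exact hp2
  exact_mod_cast this

theorem sum_Ico_eq_zero_of_odd (hp2 : p ≠ 2) {f : ℕ → ZMod p}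
    (hf : ∀ a ∈ Finset.Ico 1 p, f (p - a) = -f a) : ∑ a ∈ Finset.Ico 1 p, f a = 0 := by
  have h := sum_Ico_flip p f
  rw [Finset.sum_congr rfl hf, Finset.sum_neg_distrib] at h
  apply (mul_eq_zero.1 (?_ : (2 : ZMod p) * _ = 0)).resolve_left (two_ne_zero_zmod hp2)
  linear_combination -h

/-- In usual notation H_{p−1−c} = H_c: the full sum H_{p−1} vanishes, and its last c terms are the
negatives of the first c. -/
theorem harmonicMod_sub (hp2 : p ≠ 2) {c : ℕ} (hc : c < p) :
    harmonicMod p (p - c) = harmonicMod p (c + 1) := by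
  have h0 : harmonicMod p p = 0 := by
    apply sum_Ico_eq_zero_of_odd hp2
    intro a ha
    rw [cast_sub_prime (Finset.mem_Ico.1 ha).2.le, inv_neg]
  have h1 := Finset.sum_Ico_consecutive (fun b : ℕ => (b : ZMod p)⁻¹)
    (show 1 ≤ p - c by omega) (Nat.sub_le p c)
  have h2 := Finset.sum_Ico_reflect (fun b : ℕ => (b : ZMod p)⁻¹) 1 (show c + 1 ≤ p + 1 by omega)
  rw [show p + 1 - (c + 1) = p - c by omega, show p + 1 - 1 = p by omega] at h2
  have h3 : ∀ a ∈ Finset.Ico 1 (c + 1), (((p - a : ℕ) : ZMod p))⁻¹ = -(a : ZMod p)⁻¹ := by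
    intro a ha
    rw [Finset.mem_Ico] at ha
    rw [cast_sub_prime (by omega), inv_neg]
  rw [← h2, Finset.sum_congr rfl h3, Finset.sum_neg_distrib] at h1
  unfold harmonicMod at h0 ⊢
  linear_combination h1 + h0

theorem sum_weighted_posTriples (hp2 : p ≠ 2) (g : ℕ → ZMod p) :
    ∑ t ∈ posTriples p, g t.1 * ((t.1 : ZMod p)⁻¹ * (t.2.1 : ZMod p)⁻¹ * (t.2.2 : ZMod p)⁻¹) =
      -2 * ∑ a ∈ Finset.Ico 1 p, g a * ((a : ZMod p)⁻¹ ^ 2 * harmonicMod p (a + 1)) := by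
  rw [sum_posTriples_eq p (fun a b c =>
    g a * ((a : ZMod p)⁻¹ * (b : ZMod p)⁻¹ * (c : ZMod p)⁻¹)), Finset.mul_sum]
  refine Finset.sum_congr rfl fun a ha => ?_
  have ha0 := natCast_ne_zero_of_mem_Ico ha
  rw [Finset.mem_Ico] at ha
  -- Since b + c = −a modulo p, 1/(bc) = −(1/a)(1/b + 1/c).
  have h1 : ∀ b ∈ Finset.Ico 1 (p - a),
      g a * ((a : ZMod p)⁻¹ * (b : ZMod p)⁻¹ * ((p - a - b : ℕ) : ZMod p)⁻¹) =
      -(g a * (a : ZMod p)⁻¹ ^ 2) * ((b : ZMod p)⁻¹ + ((p - a - b : ℕ) : ZMod p)⁻¹) := by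
    intro b hb
    rw [Finset.mem_Ico] at hb
    have hb0 : (b : ZMod p) ≠ 0 := natCast_ne_zero_of_mem_Ico (Finset.mem_Ico.2 (by omega))
    have hc0 : ((p - a - b : ℕ) : ZMod p) ≠ 0 :=
      natCast_ne_zero_of_mem_Ico (Finset.mem_Ico.2 (by omega))
    have hs : (a : ZMod p) + b + (p - a - b : ℕ) = 0 := by
      have : a + b + (p - a - b) = p := by omega
      exact_mod_cast (congrArg (Nat.cast (R := ZMod p)) this).trans (by simp)
    field_simp
    linear_combination g a * hs
  rw [Finset.sum_congr rfl h1, ← Finset.mul_sum, Finset.sum_add_distrib,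
    sum_Ico_flip (p - a) (fun b : ℕ => (b : ZMod p)⁻¹)]
  have h2 := harmonicMod_sub hp2 ha.2
  rw [← h2]
  unfold harmonicMod
  ring

theorem tripleSum_prime_eq (hp2 : p ≠ 2) : tripleSum p p p =
    -2 * ∑ a ∈ Finset.Ico 1 p, (a : ZMod p)⁻¹ ^ 2 * harmonicMod p (a + 1) := by
  have := sum_weighted_posTriples hp2 (fun _ => 1)
  simp only [one_mul] at this
  rw [tripleSum_prime, this]

theorem sum_inv_cube (hp2 : p ≠ 2) : ∑ a ∈ Finset.Ico 1 p, (a : ZMod p)⁻¹ ^ 3 = 0 := by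
  apply sum_Ico_eq_zero_of_odd hp2
  intro a ha
  rw [cast_sub_prime (Finset.mem_Ico.1 ha).2.le, inv_neg]
  ring

/-- Apply a ↦ p − a to X = ∑ c(a) H_a/a². The carry becomes q − 1 − c(a), and H_{p−a} = H_{a−1} =
H_a − 1/a, so X reappears with a minus sign, leaving ∑ c(a)/a³ and a multiple of T. -/
theorem two_mul_carryTripleSum (hp2 : p ≠ 2) {q : ℕ} (hpq : p.Coprime q) (hq : 0 < q) :
    2 * carryTripleSum p q = (q - 1) * tripleSum p p p
      - 2 * ∑ a ∈ Finset.Ico 1 p, (carry p q a : ZMod p) * (a : ZMod p)⁻¹ ^ 3 := by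
  have h := sum_Ico_flip p
    (fun a => (carry p q a : ZMod p) * ((a : ZMod p)⁻¹ ^ 2 * harmonicMod p (a + 1)))
  have h1 : ∀ a ∈ Finset.Ico 1 p, (carry p q (p - a) : ZMod p) *
      (((p - a : ℕ) : ZMod p)⁻¹ ^ 2 * harmonicMod p (p - a + 1)) =
      (q - 1) * ((a : ZMod p)⁻¹ ^ 2 * harmonicMod p (a + 1)) - (q - 1) * (a : ZMod p)⁻¹ ^ 3
      - carry p q a * ((a : ZMod p)⁻¹ ^ 2 * harmonicMod p (a + 1))
      + carry p q a * (a : ZMod p)⁻¹ ^ 3 := by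
    intro a ha
    rw [Finset.mem_Ico] at ha
    have hlt := carry_lt (p := p) hq a
    rw [carry_sub hpq hq ha.2.le, cast_sub_prime ha.2.le, Nat.cast_sub (by omega),
      Nat.cast_sub (by omega), show p - a + 1 = p - (a - 1) by omega,
      harmonicMod_sub hp2 (by omega), show a - 1 + 1 = a by omega, harmonicMod_succ ha.1, inv_neg]
    push_cast
    ring
  rw [Finset.sum_congr rfl h1] at h
  simp only [Finset.sum_add_distrib, Finset.sum_sub_distrib, ← Finset.mul_sum] at h
  rw [sum_inv_cube hp2] at h
  rw [carryTripleSum, sum_weighted_posTriples hp2 (fun a => (carry p q a : ZMod p)),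
    tripleSum_prime_eq hp2]
  linear_combination 2 * h

end PartialFractions

/-! ### Power sums and Bernoulli numbers modulo p -/

/-- The map a ↦ (a + p c(a))/q permutes 1, …, p − 1: it stays below p because c(a) < q, and a is
recovered from a + p c(a) modulo p. -/
theorem sum_add_mul_carry_pow {p q : ℕ} (hpq : p.Coprime q) (hq : 0 < q) (d : ℕ) :
    ∑ a ∈ Finset.Ico 1 p, (a + p * carry p q a) ^ d =
      q ^ d * ∑ y ∈ Finset.Ico 1 p, y ^ d := by
  have hmul : ∀ a, q * ((a + p * carry p q a) / q) = a + p * carry p q a := fun a =>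
    Nat.mul_div_cancel' (dvd_add_mul_carry hpq hq a)
  have hmaps : ∀ a ∈ Finset.Ico 1 p, (a + p * carry p q a) / q ∈ Finset.Ico 1 p := by
    intro a ha
    rw [Finset.mem_Ico] at ha ⊢
    have h1 := hmul a
    constructor
    · by_contra h
      rw [Nat.lt_one_iff.1 (not_le.1 h)] at h1
      omega
    · rw [Nat.div_lt_iff_lt_mul hq]
      have h2 : p * (carry p q a + 1) ≤ p * q := Nat.mul_le_mul_left p (carry_lt hq a)
      rw [mul_add] at h2
      omega
  have hinj : Set.InjOn (fun a => (a + p * carry p q a) / q) (Finset.Ico 1 p : Finset ℕ) := by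
    intro a ha b hb h
    have h1 : a + p * carry p q a = b + p * carry p q b := by
      rw [← hmul a, ← hmul b]; exact congrArg _ h
    rw [Finset.mem_coe, Finset.mem_Ico] at ha hb
    have h2 := congrArg (· % p) h1
    simpa only [Nat.add_mul_mod_self_left, Nat.mod_eq_of_lt ha.2, Nat.mod_eq_of_lt hb.2] using h2
  rw [Finset.mul_sum]
  refine Finset.sum_nbij (fun a => (a + p * carry p q a) / q) hmaps hinj ?_ ?_
  · exact Finset.surjOn_of_injOn_of_card_le _ hmaps hinj le_rfl
  · intro a _
    rw [← mul_pow, hmul]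

section BernoulliModPrime

variable {p : ℕ} [hp : Fact p.Prime]

theorem coprime_prime_of_lt {n : ℕ} (h0 : 0 < n) (h : n < p) : n.Coprime p :=
  (hp.out.coprime_iff_not_dvd.2 (Nat.not_dvd_of_pos_of_lt h0 h)).symm

theorem coprime_den_inv_natCast_of_lt {n : ℕ} (h0 : 0 < n) (h : n < p) :
    ((n : ℚ)⁻¹).den.Coprime p :=
  Rat.coprime_den_inv_natCast (coprime_prime_of_lt h0 h)

/-- The recurrence divides only by integers at most n + 1, all smaller than p. -/
theorem coprime_den_bernoulli' {n : ℕ} (hn : n + 1 < p) : (bernoulli' n).den.Coprime p := by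
  induction n using Nat.strong_induction_on with
  | _ n ih =>
    rw [bernoulli'_def]
    refine Rat.coprime_den_sub (by simp) (Rat.coprime_den_sum fun k hk => ?_)
    rw [Finset.mem_range] at hk
    have h1 : (n : ℚ) - k + 1 = (n - k + 1 : ℕ) := by push_cast [hk.le]; ring
    rw [h1, div_eq_mul_inv]
    exact Rat.coprime_den_mul (Rat.coprime_den_mul (Rat.coprime_den_natCast _)
      (coprime_den_inv_natCast_of_lt (by omega) (by omega))) (ih k hk (by omega))

theorem coprime_den_bernoulli {n : ℕ} (hn : n + 1 < p) : (bernoulli n).den.Coprime p := by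
  rw [bernoulli]
  have h := coprime_den_bernoulli' hn
  rcases neg_one_pow_eq_or ℚ n with h' | h' <;> rw [h'] <;> simpa using h

theorem sum_range_natCast {R : Type*} [AddCommMonoid R] (f : ZMod p → R) :
    ∑ a ∈ Finset.range p, f (a : ZMod p) = ∑ x, f x := by
  refine Finset.sum_nbij' (fun a : ℕ => (a : ZMod p)) ZMod.val ?_ ?_ ?_ ?_ ?_
  · intro a _; exact Finset.mem_univ _
  · intro x _; exact Finset.mem_range.2 (ZMod.val_lt x)
  · intro a ha; exact ZMod.val_cast_of_lt (Finset.mem_range.1 ha)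
  · intro x _; exact ZMod.natCast_zmod_val x
  · intro a _; rfl

theorem sum_Ico_pow_eq_zero {e : ℕ} (h0 : 0 < e) (h : e < p - 1) :
    ∑ a ∈ Finset.Ico 1 p, (a : ZMod p) ^ e = 0 := by
  have h1 := FiniteField.sum_pow_lt_card_sub_one (ZMod p) e (by rwa [ZMod.card])
  rw [← sum_range_natCast (fun x : ZMod p => x ^ e), Finset.range_eq_Ico,
    Finset.sum_eq_sum_Ico_succ_bot hp.out.pos] at h1
  simpa [h0.ne'] using h1

theorem natCast_inv_eq_pow (hp2 : p ≠ 2) (x : ZMod p) : x⁻¹ = x ^ (p - 2) := by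
  have h3 : 3 ≤ p := by have := hp.out.two_le; omega
  by_cases hx : x = 0
  · rw [hx, inv_zero, zero_pow (by omega)]
  · have := ZMod.pow_card_sub_one_eq_one hx
    rw [show p - 1 = p - 2 + 1 by omega, pow_succ] at this
    exact (eq_inv_of_mul_eq_one_left this).symm

/-- Replace 1/b by b^(p−2) and apply Faulhaber's formula; its denominator p − 1 is −1 modulo p. -/
theorem harmonicMod_eq (hp2 : p ≠ 2) (n : ℕ) :
    harmonicMod p n = -∑ k ∈ Finset.range (p - 1),
      (bernoulli k).residue p * (p - 1).choose k * (n : ZMod p) ^ (p - 1 - k) := by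
  have h3 : 3 ≤ p := by have := hp.out.two_le; omega
  have h1 : harmonicMod p n = (∑ b ∈ Finset.range n, (b : ℚ) ^ (p - 2)).residue p := by
    have : (∑ b ∈ Finset.range n, (b : ℚ) ^ (p - 2)) = (∑ b ∈ Finset.range n, b ^ (p - 2) : ℕ) := by
      push_cast; rfl
    rw [this, Rat.residue_natCast, harmonicMod]
    push_cast
    rcases Nat.eq_zero_or_pos n with rfl | hn
    · simp
    rw [Finset.range_eq_Ico, Finset.sum_eq_sum_Ico_succ_bot hn, Nat.cast_zero,
      zero_pow (by omega), zero_add]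
    exact Finset.sum_congr rfl fun b _ => natCast_inv_eq_pow hp2 _
  have hinv : ((p - 1 : ℕ) : ZMod p)⁻¹ = -1 := by
    rw [cast_sub_prime hp.out.one_lt.le, Nat.cast_one, inv_neg, inv_one]
  have hco := coprime_den_inv_natCast_of_lt (p := p) (n := p - 1) (by omega) (by omega)
  have hb : ∀ k ∈ Finset.range (p - 1), (bernoulli k).den.Coprime p := fun k hk =>
    coprime_den_bernoulli (by rw [Finset.mem_range] at hk; omega)
  rw [h1, sum_range_pow, show p - 2 + 1 = p - 1 by omega,
    show ((p - 2 : ℕ) : ℚ) + 1 = (p - 1 : ℕ) by rw [show p - 1 = p - 2 + 1 by omega]; push_cast; rfl]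
  have hterm : ∀ k, bernoulli k * ((p - 1).choose k : ℚ) * (n : ℚ) ^ (p - 1 - k) / (p - 1 : ℕ) =
      bernoulli k * (((p - 1).choose k * n ^ (p - 1 - k) : ℕ) * ((p - 1 : ℕ) : ℚ)⁻¹) := by
    intro k; push_cast; ring
  simp only [hterm]
  rw [Rat.residue_sum fun k hk => Rat.coprime_den_mul (hb k hk)
    (Rat.coprime_den_mul (Rat.coprime_den_natCast _) hco), ← Finset.sum_neg_distrib]
  refine Finset.sum_congr rfl fun k hk => ?_
  rw [Rat.residue_mul (hb k hk) (Rat.coprime_den_mul (Rat.coprime_den_natCast _) hco),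
    Rat.residue_mul (Rat.coprime_den_natCast _) hco, Rat.residue_natCast,
    Rat.residue_inv_natCast (coprime_prime_of_lt (by omega) (by omega)) (by omega),
    hinv]
  push_cast
  ring

theorem tripleSum_prime_eq_bernoulli (hp2 : p ≠ 2) :
    tripleSum p p p = -2 * (bernoulli (p - 3)).residue p := by
  have h3 : 3 ≤ p := by have := hp.out.two_le; omega
  rw [tripleSum_prime_eq hp2]
  congr 1
  have h1 : ∀ a ∈ Finset.Ico 1 p, (a : ZMod p)⁻¹ ^ 2 * harmonicMod p (a + 1) =
      -(∑ k ∈ Finset.range (p - 1), (bernoulli k).residue p * (p - 1).choose k *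
        ((a : ZMod p)⁻¹ ^ 2 * (a : ZMod p) ^ (p - 1 - k))) + (a : ZMod p)⁻¹ ^ 3 := by
    intro a ha
    rw [harmonicMod_succ (Finset.mem_Ico.1 ha).1, harmonicMod_eq hp2, mul_add, mul_neg,
      Finset.mul_sum]
    congr 2
    · exact Finset.sum_congr rfl fun k _ => by ring
    · ring
  rw [Finset.sum_congr rfl h1, Finset.sum_add_distrib, sum_inv_cube hp2, Finset.sum_neg_distrib,
    Finset.sum_comm, add_zero]
  simp only [← Finset.mul_sum]
  -- The k-th term carries ∑ a^(p−3−k): for k = p − 3 it is p − 1 = −1, for k = p − 2 it is ∑ 1/a =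
  -- 0, and for smaller k the exponent lies strictly between 0 and p − 1, so the sum vanishes.
  rw [Finset.sum_eq_single (p - 3)]
  · have h2 : ∑ a ∈ Finset.Ico 1 p, (a : ZMod p)⁻¹ ^ 2 * (a : ZMod p) ^ (p - 1 - (p - 3)) = -1 := by
      rw [Finset.sum_congr rfl (g := fun _ => (1 : ZMod p))]
      · simp [hp.out.one_lt.le]
      · intro a ha
        rw [show p - 1 - (p - 3) = 2 by omega, ← mul_pow,
          inv_mul_cancel₀ (natCast_ne_zero_of_mem_Ico ha), one_pow]
    have h4 : ((p - 1).choose (p - 3) : ZMod p) = 1 := by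
      have h5 : (p - 1).choose (p - 3) * 2 = (p - 1) * (p - 2) := by
        rw [← Nat.choose_symm (by omega : p - 3 ≤ p - 1), show p - 1 - (p - 3) = 2 by omega,
          Nat.choose_two_right, Nat.div_mul_cancel (Nat.two_dvd_mul_sub_one _)]
        rfl
      have h6 := congrArg (Nat.cast (R := ZMod p)) h5
      rw [Nat.cast_mul, Nat.cast_mul, cast_sub_prime hp.out.one_lt.le,
        cast_sub_prime hp.out.two_le] at h6
      apply mul_right_cancel₀ (two_ne_zero_zmod hp2)
      push_cast at h6
      linear_combination h6
    rw [h2, h4]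
    ring
  · intro k hk hne
    rw [Finset.mem_range] at hk
    convert mul_zero _
    by_cases hk2 : k = p - 2
    · subst hk2
      rw [show p - 1 - (p - 2) = 1 by omega]
      apply sum_Ico_eq_zero_of_odd hp2
      intro a ha
      rw [cast_sub_prime (Finset.mem_Ico.1 ha).2.le, inv_neg]
      ring
    · rw [← sum_Ico_pow_eq_zero (p := p) (e := p - 3 - k) (by omega) (by omega)]
      refine Finset.sum_congr rfl fun a ha => ?_
      have ha0 := natCast_ne_zero_of_mem_Ico ha
      rw [show p - 1 - k = 2 + (p - 3 - k) by omega, pow_add, ← mul_assoc, ← mul_pow,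
        inv_mul_cancel₀ ha0, one_pow, one_mul]
  · intro h
    exact absurd (Finset.mem_range.2 (by omega)) h

/-- In Faulhaber's formula the linear term in p is p B_d; all the others contain p² with p-integral
coefficients. -/
theorem exists_sum_pow_eq_mul_bernoulli {d : ℕ} (hd : 0 < d) (hdp : d + 1 < p) :
    ∃ c : ℚ, c.den.Coprime p ∧
      ∑ y ∈ Finset.Ico 1 p, (y : ℚ) ^ d = p * bernoulli d + (p : ℚ) ^ 2 * c := by
  refine ⟨∑ i ∈ Finset.range d, bernoulli i *
    (((d + 1).choose i * p ^ (d - 1 - i) : ℕ) * ((d + 1 : ℕ) : ℚ)⁻¹), ?_, ?_⟩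
  · refine Rat.coprime_den_sum fun i hi => ?_
    rw [Finset.mem_range] at hi
    exact Rat.coprime_den_mul (coprime_den_bernoulli (by omega)) (Rat.coprime_den_mul
      (Rat.coprime_den_natCast _) (coprime_den_inv_natCast_of_lt (by omega) hdp))
  · have h := sum_range_pow p d
    rw [Finset.range_eq_Ico, Finset.sum_eq_sum_Ico_succ_bot hp.out.pos, Nat.cast_zero,
      zero_pow hd.ne', zero_add, zero_add, Finset.sum_range_succ] at h
    have hd1 : (d : ℚ) + 1 ≠ 0 := by positivity
    rw [h, add_comm, Finset.mul_sum]
    congr 1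
    · rw [show d + 1 - d = 1 by omega, Nat.choose_succ_self_right]
      push_cast
      field_simp
    · refine Finset.sum_congr rfl fun i hi => ?_
      rw [Finset.mem_range] at hi
      rw [show d + 1 - i = 2 + (d - 1 - i) by omega, pow_add]
      push_cast
      field_simp

/-- Voronoi's argument with d = p − 3: compare ∑ (a + p c(a))^d = q^d ∑ y^d modulo p², using ∑ y^d ≡
p B_d. Dividing by p gives (q^d − 1)B_d ≡ d ∑ c(a) a^(d−1), where d = −3, q^d = q⁻² and a^(d−1) =
a⁻³ modulo p. -/
theorem three_mul_sum_carry (hp2 : p ≠ 2) {q : ℕ} (hpq : p.Coprime q) (hq : 0 < q) :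
    3 * ∑ a ∈ Finset.Ico 1 p, (carry p q a : ZMod p) * (a : ZMod p)⁻¹ ^ 3 =
      (1 - (q : ZMod p)⁻¹ ^ 2) * (bernoulli (p - 3)).residue p := by
  have hq0 : (q : ZMod p) ≠ 0 := by
    rw [Ne, ZMod.natCast_eq_zero_iff]
    exact fun h => hp.out.one_lt.ne' (Nat.eq_one_of_dvd_coprimes hpq dvd_rfl h)
  -- Here d = 0 and the power-sum estimate does not apply, but both sides vanish since 3 = 0 and q²
  -- = 1.
  by_cases hp3 : p = 3
  · subst hp3
    have h1 : (q : ZMod 3) ^ 2 = 1 := ZMod.pow_card_sub_one_eq_one hq0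
    rw [inv_pow, h1, show (3 : ZMod 3) = 0 from rfl]
    simp
  have h5 : 5 ≤ p := by
    have := hp.out.two_le
    have h4 : p ≠ 4 := by rintro rfl; exact absurd hp.out (by decide)
    omega
  obtain ⟨c, hc, hS⟩ := exists_sum_pow_eq_mul_bernoulli (p := p) (d := p - 3) (by omega) (by omega)
  have hV := sum_add_mul_carry_pow hpq hq (p - 3)
  have hexp : ∀ a : ℕ, ∃ k : ℕ, (a + p * carry p q a) ^ (p - 3) =
      a ^ (p - 3) + (p - 3 : ℕ) * a ^ (p - 3 - 1) * (p * carry p q a) + k * (p * carry p q a) ^ 2 :=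
    fun a => ⟨(Polynomial.powAddExpansion a (p * carry p q a) (p - 3)).1,
      (Polynomial.powAddExpansion a (p * carry p q a) (p - 3)).2⟩
  choose k hk using hexp
  set V : ℕ := ∑ a ∈ Finset.Ico 1 p, carry p q a * a ^ (p - 4) with hVdef
  set K : ℕ := ∑ a ∈ Finset.Ico 1 p, k a * carry p q a ^ 2 with hKdef
  have hV2 : q ^ (p - 3) * ∑ y ∈ Finset.Ico 1 p, y ^ (p - 3) =
      ∑ y ∈ Finset.Ico 1 p, y ^ (p - 3) + (p - 3) * p * V + p ^ 2 * K := by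
    rw [← hV, hVdef, hKdef, Finset.mul_sum, Finset.mul_sum, ← Finset.sum_add_distrib,
      ← Finset.sum_add_distrib]
    refine Finset.sum_congr rfl fun a _ => ?_
    rw [hk a, show p - 3 - 1 = p - 4 by omega]
    ring
  have hQ := congrArg (Nat.cast (R := ℚ)) hV2
  push_cast at hQ
  rw [hS] at hQ
  have hp0 : (p : ℚ) ≠ 0 := by exact_mod_cast hp.out.ne_zero
  set B := bernoulli (p - 3) with hB
  have hBco : B.den.Coprime p := coprime_den_bernoulli (by omega)
  have hQ2 : (q ^ (p - 3) : ℕ) * (B + p * c) = B + p * c + ((p - 3) * V + p * K : ℕ) := by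
    apply mul_left_cancel₀ hp0
    push_cast
    linear_combination hQ
  have hpc := Rat.coprime_den_mul (Rat.coprime_den_natCast (N := p) p) hc
  have hBc := Rat.coprime_den_add hBco hpc
  have hR := congrArg (Rat.residue p) hQ2
  rw [Rat.residue_mul (Rat.coprime_den_natCast _) hBc,
    Rat.residue_add hBc (Rat.coprime_den_natCast _), Rat.residue_add hBco hpc,
    Rat.residue_mul (Rat.coprime_den_natCast p) hc, Rat.residue_natCast, Rat.residue_natCast,
    Rat.residue_natCast] at hR
  push_cast at hR
  rw [cast_sub_prime (by omega : 3 ≤ p), ZMod.natCast_self] at hR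
  have hpow : ∀ x : ZMod p, x ≠ 0 → ∀ i ≤ p - 1, x ^ (p - 1 - i) = x⁻¹ ^ i := by
    intro x hx i hi
    have h1 := ZMod.pow_card_sub_one_eq_one hx
    rw [show p - 1 = (p - 1 - i) + i by omega, pow_add] at h1
    rw [inv_pow]
    exact eq_inv_of_mul_eq_one_left h1
  have e1 : (q : ZMod p) ^ (p - 3) = (q : ZMod p)⁻¹ ^ 2 := hpow _ hq0 2 (by omega)
  have e2 : (V : ZMod p) = ∑ a ∈ Finset.Ico 1 p, (carry p q a : ZMod p) * (a : ZMod p)⁻¹ ^ 3 := by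
    rw [hVdef]
    push_cast
    refine Finset.sum_congr rfl fun a ha => ?_
    rw [← hpow _ (natCast_ne_zero_of_mem_Ico ha) 3 (by omega)]
    rfl
  rw [e1, e2] at hR
  push_cast at hR
  linear_combination hR

/-- Eliminating the carry sums leaves q − 2 − q⁻² + 2q⁻³, which factors as (q − 2)(1 − q⁻³). -/
theorem tripleSum_mul_prime_eq_bernoulli (hp2 : p ≠ 2) {q r : ℕ} (hq : q.Prime) (hpq : p ≠ q)
    (hr : 0 < r) :
    tripleSum (p * q) p (q * r * p) =
      -2 * r * (q - 2) * (1 - (q : ZMod p)⁻¹ ^ 3) * (bernoulli (p - 3)).residue p := by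
  have hco : p.Coprime q := (Nat.coprime_primes hp.out hq).2 hpq
  have hq0 : (q : ZMod p) ≠ 0 := by
    rw [Ne, ZMod.natCast_eq_zero_iff]
    exact fun h => hp.out.one_lt.ne' (Nat.eq_one_of_dvd_coprimes hco dvd_rfl h)
  have hqi : (q : ZMod p) * (q : ZMod p)⁻¹ = 1 := mul_inv_cancel₀ hq0
  have h1 := tripleSum_mul_prime hq hpq hr
  have h2 := two_mul_carryTripleSum hp2 hco hq.pos
  have h3 := three_mul_sum_carry hp2 hco hq.pos
  rw [tripleSum_prime_eq_bernoulli hp2] at h1 h2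
  rw [h1]
  linear_combination 3 * (r : ZMod p) * h2 - 2 * r * h3
    + 2 * r * (q : ZMod p)⁻¹ ^ 2 * (-1) * (bernoulli (p - 3)).residue p * hqi

end BernoulliModPrime

/-! ### Return to rational sums and to powers of p -/

theorem coprimeTriples_eq_filter (D n : ℕ) : coprimeTriples D n = (posTriples n).filter
    fun t => t.1.Coprime D ∧ t.2.1.Coprime D ∧ t.2.2.Coprime D := by
  rw [coprimeTriples, posTriples, Finset.filter_filter]

theorem residue_sum_coprimeTriples {D N : ℕ} (hDN : ∀ i : ℕ, i.Coprime D → i.Coprime N) (n : ℕ)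
    (c : ℕ → ℤ) :
    (∑ t ∈ coprimeTriples D n, (c t.1 : ℚ) / ((t.1 : ℚ) * (t.2.1 : ℚ) * (t.2.2 : ℚ))).den.Coprime
        N ∧
      (∑ t ∈ coprimeTriples D n,
        (c t.1 : ℚ) / ((t.1 : ℚ) * (t.2.1 : ℚ) * (t.2.2 : ℚ))).residue N =
      ∑ t ∈ posTriples n,
        c t.1 * (coprimeInv D N t.1 * coprimeInv D N t.2.1 * coprimeInv D N t.2.2) := by
  have hterm : ∀ t : ℕ × ℕ × ℕ, (c t.1 : ℚ) / ((t.1 : ℚ) * (t.2.1 : ℚ) * (t.2.2 : ℚ)) =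
      c t.1 * ((t.1 : ℚ)⁻¹ * (t.2.1 : ℚ)⁻¹ * (t.2.2 : ℚ)⁻¹) := by
    intro t; rw [div_eq_mul_inv, mul_inv, mul_inv]
  simp only [hterm]
  have hmem : ∀ t ∈ coprimeTriples D n, (t.1.Coprime D ∧ t.2.1.Coprime D ∧ t.2.2.Coprime D) ∧
      t.1 ≠ 0 ∧ t.2.1 ≠ 0 ∧ t.2.2 ≠ 0 := by
    intro t ht
    rw [coprimeTriples_eq_filter, Finset.mem_filter, mem_posTriples] at ht
    exact ⟨ht.2, by omega⟩
  have hd : ∀ {i : ℕ}, i.Coprime D → ((i : ℚ)⁻¹).den.Coprime N := fun h =>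
    Rat.coprime_den_inv_natCast (hDN _ h)
  have hd2 : ∀ t ∈ coprimeTriples D n, ((t.1 : ℚ)⁻¹ * (t.2.1 : ℚ)⁻¹).den.Coprime N := fun t ht =>
    Rat.coprime_den_mul (hd (hmem t ht).1.1) (hd (hmem t ht).1.2.1)
  have hd3 : ∀ t ∈ coprimeTriples D n,
      ((t.1 : ℚ)⁻¹ * (t.2.1 : ℚ)⁻¹ * (t.2.2 : ℚ)⁻¹).den.Coprime N := fun t ht =>
    Rat.coprime_den_mul (hd2 t ht) (hd (hmem t ht).1.2.2)
  have hd4 : ∀ t ∈ coprimeTriples D n,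
      ((c t.1 : ℚ) * ((t.1 : ℚ)⁻¹ * (t.2.1 : ℚ)⁻¹ * (t.2.2 : ℚ)⁻¹)).den.Coprime N := fun t ht =>
    Rat.coprime_den_mul (Rat.coprime_den_intCast _) (hd3 t ht)
  refine ⟨Rat.coprime_den_sum hd4, ?_⟩
  rw [Rat.residue_sum hd4]
  have hr : ∀ {i : ℕ}, i.Coprime D → i ≠ 0 → ((i : ℚ)⁻¹).residue N = coprimeInv D N i := by
    intro i h h0
    rw [Rat.residue_inv_natCast (hDN i h) h0, coprimeInv, if_pos h]
  have hsub : coprimeTriples D n ⊆ posTriples n := by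
    rw [coprimeTriples_eq_filter]; exact Finset.filter_subset _ _
  rw [← Finset.sum_subset hsub]
  · refine Finset.sum_congr rfl fun t ht => ?_
    obtain ⟨⟨h1, h2, h3⟩, n1, n2, n3⟩ := hmem t ht
    rw [Rat.residue_mul (Rat.coprime_den_intCast _) (hd3 t ht), Rat.residue_intCast,
      Rat.residue_mul (hd2 t ht) (hd h3), Rat.residue_mul (hd h1) (hd h2), hr h1 n1, hr h2 n2,
      hr h3 n3]
  · intro t ht hnot
    rw [coprimeTriples_eq_filter, Finset.mem_filter] at hnot
    have hnot' : ¬ (t.1.Coprime D ∧ t.2.1.Coprime D ∧ t.2.2.Coprime D) := fun h => hnot ⟨ht, h⟩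
    rcases not_and_or.1 hnot' with h | h
    · simp [coprimeInv_of_not_coprime h]
    · rcases not_and_or.1 h with h | h <;> simp [coprimeInv_of_not_coprime h]

theorem coprime_pow_mul_pow_iff {p q α β i : ℕ} (hα : 0 < α) (hβ : 0 < β) :
    i.Coprime (p ^ α * q ^ β) ↔ i.Coprime (p * q) := by
  rw [Nat.coprime_mul_iff_right, Nat.coprime_mul_iff_right, Nat.coprime_pow_right_iff hα,
    Nat.coprime_pow_right_iff hβ]

theorem coprimeTriples_pow_mul_pow {p q α β : ℕ} (hα : 0 < α) (hβ : 0 < β) (n : ℕ) :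
    coprimeTriples (p ^ α * q ^ β) n = coprimeTriples (p * q) n := by
  rw [coprimeTriples_eq_filter, coprimeTriples_eq_filter]
  simp only [coprime_pow_mul_pow_iff hα hβ]

section PrimePowers

variable {p q : ℕ}

theorem coprime_prime_pow_of_coprime_mul (a : ℕ) (i : ℕ) (h : i.Coprime (p * q)) :
    i.Coprime (p ^ a) :=
  Nat.Coprime.pow_right _ h.coprime_mul_right_right

theorem residue_harmonicZ {α β : ℕ} (hα : 0 < α) (hβ : 0 < β) (a : ℕ) :
    (harmonicZ (p ^ α * q ^ β)).den.Coprime (p ^ a) ∧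
      (harmonicZ (p ^ α * q ^ β)).residue (p ^ a) =
        tripleSum (p * q) (p ^ a) (p ^ α * q ^ β) := by
  have h := residue_sum_coprimeTriples (coprime_prime_pow_of_coprime_mul (p := p) (q := q) a)
    (p ^ α * q ^ β) (fun _ => 1)
  simp only [Int.cast_one, one_mul] at h
  rwa [harmonicZ, coprimeTriples_pow_mul_pow hα hβ, tripleSum]

theorem residue_alternating_sum (a n : ℕ) :
    (∑ t ∈ coprimeTriples (p * q) n,
      (-1 : ℚ) ^ t.1 / ((t.1 : ℚ) * (t.2.1 : ℚ) * (t.2.2 : ℚ))).den.Coprime (p ^ a) ∧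
    (∑ t ∈ coprimeTriples (p * q) n,
      (-1 : ℚ) ^ t.1 / ((t.1 : ℚ) * (t.2.1 : ℚ) * (t.2.2 : ℚ))).residue (p ^ a) =
        alternatingTripleSum (p * q) (p ^ a) n := by
  have h := residue_sum_coprimeTriples (coprime_prime_pow_of_coprime_mul (p := p) (q := q) a)
    n (fun i => (-1) ^ i)
  simp only [Int.cast_pow, Int.cast_neg, Int.cast_one] at h
  rwa [alternatingTripleSum]

theorem ratModEq_three_mul {n N : ℕ} {S Z : ℚ} (hS : S.den.Coprime N) (hZ : Z.den.Coprime N)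
    (hSr : S.residue N = alternatingTripleSum (p * q) N n)
    (hZr : Z.residue N = tripleSum (p * q) N n)
    (h : 3 * (4 * alternatingTripleSum (p * q) N n + tripleSum (p * q) N n) = 0) :
    RatModEq N ((3 : ℕ) * ((4 : ℕ) * S)) ((3 : ℕ) * -Z) := by
  have h4 := Rat.coprime_den_mul (Rat.coprime_den_natCast 4) hS
  have hn := Rat.coprime_den_neg hZ
  rw [ratModEq_iff_residue]
  refine ⟨Rat.coprime_den_mul (Rat.coprime_den_natCast 3) h4,
    Rat.coprime_den_mul (Rat.coprime_den_natCast 3) hn, ?_⟩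
  rw [Rat.residue_mul (Rat.coprime_den_natCast 3) h4,
    Rat.residue_mul (Rat.coprime_den_natCast 4) hS,
    Rat.residue_mul (Rat.coprime_den_natCast 3) hn, Rat.residue_neg, Rat.residue_natCast,
    Rat.residue_natCast, hSr, hZr]
  push_cast
  linear_combination h

theorem ratModEq_alternating_harmonicZ (hp : p.Prime) (hq : q.Prime) (hp2 : p ≠ 2) (hq2 : q ≠ 2)
    {a β : ℕ} (hβ : 0 < β) :
    RatModEq (p ^ (a + 1))
      (∑ t ∈ coprimeTriples (p * q) (p ^ (a + 1) * q ^ β),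
        (-1 : ℚ) ^ t.1 / ((t.1 : ℚ) * (t.2.1 : ℚ) * (t.2.2 : ℚ)))
      (-(1 / 4 : ℚ) * harmonicZ (p ^ (a + 1) * q ^ β)) := by
  set n := p ^ (a + 1) * q ^ β with hn
  set S := ∑ t ∈ coprimeTriples (p * q) n,
        (-1 : ℚ) ^ t.1 / ((t.1 : ℚ) * (t.2.1 : ℚ) * (t.2.2 : ℚ)) with hS
  have hD : p * q ≠ 1 := by
    have := Nat.mul_le_mul hp.two_le hq.two_le; omega
  have hDn : p * q ∣ n := Nat.mul_dvd_mul (dvd_pow_self p (by omega)) (dvd_pow_self q hβ.ne')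
  have hodd : Odd n := (hp.odd_of_ne_two hp2).pow.mul (hq.odd_of_ne_two hq2).pow
  have key : RatModEq (p ^ (a + 1)) ((4 : ℕ) * S) (-harmonicZ n) := by
    -- For p = 3 work modulo 3^(a+2), where 3n and n² still vanish, then cancel 3; otherwise n = 0
    -- modulo p^(a+1) and 3 is invertible.
    by_cases hp3 : p = 3
    · apply RatModEq.of_natCast_mul hp.ne_zero
        (Rat.coprime_den_mul (Rat.coprime_den_natCast 4) (residue_alternating_sum (a + 1) n).1)
        (Rat.coprime_den_neg (residue_harmonicZ (by omega) hβ _).1)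
      have hmul := ratModEq_three_mul (residue_alternating_sum (a + 2) n).1
        (residue_harmonicZ (by omega) hβ (a + 2)).1 (residue_alternating_sum (a + 2) n).2
        (residue_harmonicZ (by omega) hβ (a + 2)).2
        (three_mul_alternatingTripleSum (coprime_prime_pow_of_coprime_mul (a + 2)) hD hDn hodd
          ?_ ?_)
      · rw [← hn, ← hS] at hmul
        convert hmul
      · rw [← Nat.cast_mul, ZMod.natCast_eq_zero_iff]
        exact ⟨p ^ a * q ^ β * q ^ β, by rw [hn]; ring⟩
      · have h3 : ((3 : ℕ) : ZMod (p ^ (a + 2))) * n = 0 := by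
          rw [← Nat.cast_mul, ZMod.natCast_eq_zero_iff, hn]
          exact ⟨q ^ β, by rw [hp3]; ring⟩
        exact_mod_cast h3
    · have h0 : (n : ZMod (p ^ (a + 1))) = 0 := by
        rw [ZMod.natCast_eq_zero_iff]; exact Dvd.intro _ rfl
      have hmul := ratModEq_three_mul (residue_alternating_sum (a + 1) n).1
        (residue_harmonicZ (by omega) hβ (a + 1)).1 (residue_alternating_sum (a + 1) n).2
        (residue_harmonicZ (by omega) hβ (a + 1)).2
        (three_mul_alternatingTripleSum (coprime_prime_pow_of_coprime_mul (a + 1)) hD hDn hodd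
          (by rw [h0, zero_mul]) (by rw [h0, mul_zero]))
      have h3 : Nat.Coprime 3 (p ^ (a + 1)) :=
        Nat.Coprime.pow_right _ ((Nat.coprime_primes Nat.prime_three hp).2 (Ne.symm hp3))
      have := hmul.mul_left (Rat.coprime_den_inv_natCast h3)
      rwa [← mul_assoc, ← mul_assoc (((3 : ℕ) : ℚ)⁻¹) _ (-_), inv_mul_cancel₀ (by norm_num),
        one_mul, one_mul] at this
  have h4 : Nat.Coprime 4 (p ^ (a + 1)) :=
    Nat.Coprime.pow_right _ (((Nat.coprime_primes Nat.prime_two hp).2 (Ne.symm hp2)).pow_left 2)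
  have := key.mul_left (Rat.coprime_den_inv_natCast h4)
  convert this using 1
  · push_cast; ring
  · push_cast; ring

theorem ratModEq_harmonicZ (hp : p.Prime) (hq : q.Prime) (hp2 : p ≠ 2) (hpq : p ≠ q) {a β : ℕ}
    (hβ : 0 < β) :
    RatModEq (p ^ (a + 1)) (harmonicZ (p ^ (a + 1) * q ^ β))
      (-2 * ((q : ℚ) - 2) * (1 - 1 / (q : ℚ) ^ 3) * (p : ℚ) ^ a * (q : ℚ) ^ (β - 1) *
        bernoulli (p - 3)) := by
  have : Fact p.Prime := ⟨hp⟩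
  have hco : q.Coprime p := (Nat.coprime_primes hq hp).2 hpq.symm
  induction a with
  | zero =>
    obtain ⟨hd, hr⟩ := residue_harmonicZ (p := p) (q := q) (α := 0 + 1) zero_lt_one hβ 1
    rw [zero_add, pow_one] at hd hr ⊢
    have hB : (bernoulli (p - 3)).den.Coprime p :=
      coprime_den_bernoulli (by have := hp.two_le; omega)
    have hqi := Rat.coprime_den_inv_natCast hco
    have hqi3 : ((q : ℚ)⁻¹ * ((q : ℚ)⁻¹ * (q : ℚ)⁻¹)).den.Coprime p :=
      Rat.coprime_den_mul hqi (Rat.coprime_den_mul hqi hqi)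
    have h1 := Rat.coprime_den_sub (Rat.coprime_den_intCast (N := p) 1) hqi3
    have h2 := Rat.coprime_den_mul h1 hB
    have e : -2 * ((q : ℚ) - 2) * (1 - 1 / (q : ℚ) ^ 3) * (p : ℚ) ^ 0 * (q : ℚ) ^ (β - 1) *
        bernoulli (p - 3) = ((-2 * ((q : ℤ) - 2) * q ^ (β - 1) : ℤ) : ℚ) *
          ((((1 : ℤ) : ℚ) - (q : ℚ)⁻¹ * ((q : ℚ)⁻¹ * (q : ℚ)⁻¹)) * bernoulli (p - 3)) := by
      push_cast
      rw [one_div, ← inv_pow]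
      ring
    rw [e, ratModEq_iff_residue]
    refine ⟨hd, Rat.coprime_den_mul (Rat.coprime_den_intCast _) h2, ?_⟩
    rw [hr, Rat.residue_mul (Rat.coprime_den_intCast _) h2, Rat.residue_mul h1 hB,
      Rat.residue_sub (Rat.coprime_den_intCast 1) hqi3,
      Rat.residue_mul hqi (Rat.coprime_den_mul hqi hqi), Rat.residue_mul hqi hqi,
      Rat.residue_inv_natCast hco hq.ne_zero, Rat.residue_intCast, Rat.residue_intCast]
    have hbase := tripleSum_mul_prime_eq_bernoulli hp2 hq hpq
      (Nat.pow_pos (n := β - 1) hq.pos)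
    have hpow : q * q ^ (β - 1) * p = p * q ^ β := by
      rw [← pow_succ', Nat.sub_add_cancel hβ, mul_comm]
    rw [hpow] at hbase
    rw [hbase]
    push_cast
    ring
  | succ a ih =>
    -- The factor p on the right lifts the inductive congruence from modulus p^(a+1) to p^(a+2).
    have hstep : RatModEq (p ^ (a + 2)) (harmonicZ (p ^ (a + 2) * q ^ β))
        (p * harmonicZ (p ^ (a + 1) * q ^ β)) := by
      obtain ⟨hd, hr⟩ := residue_harmonicZ (p := p) (q := q) (α := a + 2) (by omega) hβ (a + 2)
      obtain ⟨hd', hr'⟩ := residue_harmonicZ (p := p) (q := q) (α := a + 1) (by omega) hβ (a + 2)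
      rw [ratModEq_iff_residue]
      refine ⟨hd, Rat.coprime_den_mul (Rat.coprime_den_natCast p) hd', ?_⟩
      rw [Rat.residue_mul (Rat.coprime_den_natCast p) hd', Rat.residue_natCast, hr, hr',
        ← tripleSum_prime_mul hp hp2 (Dvd.intro q rfl) (Nat.pow_pos hq.pos)
          (Nat.mul_dvd_mul (dvd_pow_self p (by omega)) (dvd_pow_self q hβ.ne'))]
      congr 1
      ring
    have := hstep.trans ih.natCast_mul_succ
    convert this using 1
    ring

end PrimePowers

theorem theorem2 (p q α β : ℕ) (hp : Nat.Prime p) (hq : Nat.Prime q)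
    (hp2 : p ≠ 2) (hq2 : q ≠ 2) (hpq : p ≠ q) (hα : 0 < α) (hβ : 0 < β) :
    RatModEq (p ^ α)
        (∑ t ∈ coprimeTriples (p * q) (p ^ α * q ^ β),
          (-1 : ℚ) ^ t.1 / ((t.1 : ℚ) * (t.2.1 : ℚ) * (t.2.2 : ℚ)))
        (-(1 / 4 : ℚ) * harmonicZ (p ^ α * q ^ β)) ∧
      RatModEq (p ^ α)
        (-(1 / 4 : ℚ) * harmonicZ (p ^ α * q ^ β))
        ((1 / 2 : ℚ) * ((q : ℚ) - 2) * (1 - 1 / (q : ℚ) ^ 3) * (p : ℚ) ^ (α - 1)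
          * (q : ℚ) ^ (β - 1) * bernoulli (p - 3)) := by
  obtain ⟨a, rfl⟩ : ∃ a, α = a + 1 := ⟨α - 1, by omega⟩
  refine ⟨ratModEq_alternating_harmonicZ hp hq hp2 hq2 hβ, ?_⟩
  have h4 : Nat.Coprime 4 (p ^ (a + 1)) :=
    Nat.Coprime.pow_right _ (((Nat.coprime_primes Nat.prime_two hp).2 (Ne.symm hp2)).pow_left 2)
  have := (ratModEq_harmonicZ hp hq hp2 hpq (a := a) hβ).mul_left
    (Rat.coprime_den_neg (Rat.coprime_den_inv_natCast h4))
  convert this using 1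
  · push_cast; ring
  · rw [Nat.add_sub_cancel]; push_cast; ring
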